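/- Let $\mathbb H$ be the quaternions with the Euclidean norm, $B(0;R)=\{q\in\mathbb H:\|q\|<R\}$, $\mathbb S=\{I\in\mathbb H: \mathrm{Re}\,I=0,\ \|I\|=1\}$ and, for $I\in\mathbb S$, $\mathbb C_I=\{x+Iy: x,y\in\mathbb R\}$. A function $f:B(0;1)\to\mathbb H$ is (left) slice regular if it is real differentiable and for every $I\in\mathbb S$ one has $\frac12\left(\frac{\partial}{\partial x}+I\frac{\partial}{\partial y}\right)f(x+Iy)=0$ on $B(0;1)\cap\mathbb C_I$. Its slice derivative is $\partial_s f(x+Iy)=\frac12\left(\frac{\partial}{\partial x}-I\frac{\partial}{\partial y}\right)f(x+Iy)$ for $y\neq 0$, and $\partial_s f(x)=\frac{\partial f}{\partial x}(x)$ for $x$ real. It is intrinsic if $f(B(0;1)\cap\mathbb C_I)\subset\mathbb C_I$ for every $I\in\mathbb S$, and univalent if it is injective on $B(0;1)$. Writing $f(x+Iy)=\alpha(x,y)+I\beta(x,y)$ and $g(x+Iy)=\gamma(x,y)+I\delta(x,y)$, with $\alpha,\gamma$ even in $y$, $\beta,\delta$ odd in $y$ and none of them depending on $I$, the slice regular product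 is $f*g=(\alpha\gamma-\beta\delta)+I(\alpha\delta+\beta\gamma)$, the regular conjugate is $f^c=\overline{\alpha}+I\overline{\beta}$, and the slice regular reciprocal is $f^{-*}=(f*f^c)^{-1}f^c$, defined where $f*f^c\neq 0$. **Theorem.** Let $f:B(0;1)\to\mathbb H$ be slice regular, univalent and intrinsic, with $f(0)=0$ and $\partial_s f(0)=1$. Then: 1. $B(0;\frac14)\subset f(B(0;1))$. 2. $\displaystyle \frac{1-r}{(1+r)^3}\le\|\partial_s f(q)\|\le\frac{1+r}{(1-r)^3}$ whenever $0<\|q\|=r<1$. 3. $\displaystyle \frac{r}{(1+r)^2}\le\|f(q)\|\le\frac{r}{(1-r)^2}$ whenever $0<\|q\|=r<1$. 4. $\displaystyle \frac{1-r}{1+r}\le\|(q\,\partial_s f * f^{-*})(q)\|\le\frac{1+r}{1-r}$ whenever $0<\|q\|=r<1$. 5. For every $I\in\mathbb S$ and every $0<r<1$, the function $\theta\mapsto\|\partial_s f(re^{I\theta})\|$, where $e^{I\theta}=\cos\theta+I\sin\theta$, is integrable on $[0,2\pi]$ and $\displaystyle r\int_0^{2\pi}\|\partial_s f(re^{I\theta})\|\,d\theta\le\frac{2\pi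 r(1+r)}{(1-r)^2}.$ -/

import Mathlib

open scoped Quaternion

noncomputable section

namespace SliceRegular

/-- The sphere `𝕊` of imaginary units of the quaternions. -/
def imagUnits : Set ℍ := {I | I.re = 0 ∧ ‖I‖ = 1}

/-- The complex plane `ℂ_I = ℝ + I ℝ`. -/
def slicePlane (I : ℍ) : Set ℍ := {q | ∃ x y : ℝ, q = (x : ℍ) + I * (y : ℍ)}

/-- `f` is (left) slice regular on the open set `U`: it is real differentiable on `U` and, for every
imaginary unit `I`, `∂̄_I f = (1/2) (∂/∂x + I ∂/∂y) f_I` vanishes on `U ∩ ℂ_I`. At `q = x + I y` the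
partial derivatives of `f_I` with respect to `x` and to `y` are the derivatives of `f` at `q` along
the vectors `1` and `I`. -/
def IsSliceRegularOn (f : ℍ → ℍ) (U : Set ℍ) : Prop :=
  DifferentiableOn ℝ f U ∧
    ∀ I ∈ imagUnits, ∀ q ∈ U ∩ slicePlane I,
      (1 / 2 : ℝ) • (lineDeriv ℝ f q 1 + I * lineDeriv ℝ f q I) = 0

/-- The imaginary unit `I_q` with `q = re q + I_q ‖im q‖`; at a real `q` it is chosen to be `i`. -/
def imagUnit (q : ℍ) : ℍ :=
  open Classical in if q.im = 0 then (Complex.I : ℍ) else ‖q.im‖⁻¹ • q.im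

/-- The slice derivative `∂_s f`: it is `∂_I f = (1/2) (∂/∂x - I ∂/∂y) f_I` at a non-real
`q = x + I y`, and `∂f/∂x` at a real `q`. -/
def sliceDeriv (f : ℍ → ℍ) (q : ℍ) : ℍ :=
  open Classical in
  if q.im = 0 then lineDeriv ℝ f q 1
  else (1 / 2 : ℝ) • (lineDeriv ℝ f q 1 - imagUnit q * lineDeriv ℝ f q (imagUnit q))

/-- `f` is quaternionic intrinsic on `U`, that is, `f ∈ 𝒩(U)`. -/
def IsIntrinsicOn (f : ℍ → ℍ) (U : Set ℍ) : Prop :=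
  IsSliceRegularOn f U ∧ ∀ I ∈ imagUnits, Set.MapsTo f (U ∩ slicePlane I) (slicePlane I)

/-- The class `𝒮` of normalized univalent slice regular functions on the unit ball `B(0;1)`. -/
def IsNormalizedUnivalent (f : ℍ → ℍ) : Prop :=
  IsSliceRegularOn f (Metric.ball 0 1) ∧ Set.InjOn f (Metric.ball 0 1) ∧
    f 0 = 0 ∧ sliceDeriv f 0 = 1

/-- The component `α` in `f (x + I y) = α (x, y) + I β (x, y)`, where `α` is even in `y` and `β` is
odd in `y`, as a function of `q = x + I_q y` with `y = ‖im q‖`. -/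
def stemRe (f : ℍ → ℍ) (q : ℍ) : ℍ := (1 / 2 : ℝ) • (f q + f (star q))

/-- The component `β` in `f (x + I y) = α (x, y) + I β (x, y)`, where `α` is even in `y` and `β` is
odd in `y`, as a function of `q = x + I_q y` with `y = ‖im q‖`. -/
def stemIm (f : ℍ → ℍ) (q : ℍ) : ℍ := -((1 / 2 : ℝ) • (imagUnit q * (f q - f (star q))))

/-- The slice regular product
`(α + I β) * (γ + I δ) = (α γ - β δ) + I (α δ + β γ)`. -/
def starMul (f g : ℍ → ℍ) (q : ℍ) : ℍ :=
  (stemRe f q * stemRe g q - stemIm f q * stemIm g q) +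
    imagUnit q * (stemRe f q * stemIm g q + stemIm f q * stemRe g q)

/-- The regular conjugate `f^c = ᾱ + I β̄` of `f = α + I β`. -/
def regConj (f : ℍ → ℍ) (q : ℍ) : ℍ := star (stemRe f q) + imagUnit q * star (stemIm f q)

/-- The symmetrization `f^s = f * f^c`. -/
def symmetrization (f : ℍ → ℍ) : ℍ → ℍ := starMul f (regConj f)

/-- The slice regular reciprocal `f^{-*} = (f^s)⁻¹ f^c`, meaningful where `f^s ≠ 0`. -/
def starInv (f : ℍ → ℍ) (q : ℍ) : ℍ := (symmetrization f q)⁻¹ * regConj f q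

end SliceRegular

end

/-! An intrinsic slice regular function maps each slice `ℂ_I` into itself. The map `x + iy ↦ x + Iy`
is an isometric algebra embedding of `ℂ`, so the restriction becomes a holomorphic function on the
unit disk, injective and normalized like `f`. Every quaternion lies on a slice, and the slice
derivative restricts to the complex derivative. The theorem is therefore the classical theory of
univalent functions, read on one slice at a time.

Only the fourth claim involves the star product. An intrinsic function takes real values at real
points, since distinct slices meet in `ℝ`, so its restriction commutes with conjugation
(`IsIntrinsicOn.sliceRestrict_conj`). Its components `α`, `β` are then real, and the star operations
become pointwise ones in the commutative field `ℂ_I`.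

The classical chain starts from the area theorem for `z⁻¹ + φ z`. It is obtained by comparing the
area of the image of an annulus with that of a disk containing it, after a real linear map has
rounded the outer boundary. The square root transform turns it into Bieberbach's bound, and an
omitted value then gives the quarter theorem. Applied to `f` composed with a map onto a slit disk,
this yields the lower growth bound. The Koebe transform moves that bound to any base point and
becomes an upper bound for `|z f'/f|`. Integration along a radius gives the upper growth bound, and
a second Koebe transform gives the lower bound for `|z f'/f|`. The distortion bounds are products of
these.

For the integral, Littlewood's argument bounds the mean of `|f|` by the area of images under the
square root transform; the bound on `|z f'/f|` then passes from `f` to `f'`. -/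

/-! ### Parseval's identity on circles. -/

open Complex Metric Set MeasureTheory Filter Topology Real in
theorem fourierCoeffOn_circleMap (g : ℂ → ℂ) {t : ℝ} (ht : 0 < t) (m : ℤ) :
    fourierCoeffOn Real.two_pi_pos (fun θ => g (circleMap 0 t θ)) m =
      Real.circleAverage (fun z => (t / z) ^ m * g z) 0 t := by
  rw [fourierCoeffOn_eq_integral, Real.circleAverage_def]
  simp only [sub_zero, one_div]
  congr 1
  refine intervalIntegral.integral_congr fun θ _ => ?_
  have hπ : (Real.pi : ℂ) ≠ 0 := by exact_mod_cast Real.pi_ne_zero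
  have ht' : (t : ℂ) ≠ 0 := by exact_mod_cast ht.ne'
  simp only [smul_eq_mul]
  congr 1
  rw [fourier_coe_apply, circleMap_zero, div_mul_cancel_left₀ ht', ← Complex.exp_neg,
    ← Complex.exp_int_mul]
  congr 1
  push_cast
  field_simp
  ring

open Complex Metric Set MeasureTheory Filter Topology Real in
-- Parseval for `θ ↦ g (t e^{iθ})`: Cauchy's formula identifies the Fourier coefficients of index `n
-- ≥ 0` with Taylor coefficients times `t ^ n`, and the negative ones vanish.
theorem hasSum_sq_taylorCoeff_circleAverage {g : ℂ → ℂ} {R t : ℝ}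
    (hg : DifferentiableOn ℂ g (ball 0 R)) (ht : 0 < t) (htR : t < R) :
    HasSum (fun n : ℕ => ‖iteratedDeriv n g 0 / (n.factorial : ℂ)‖ ^ 2 * t ^ (2 * n))
      (Real.circleAverage (fun z => ‖g z‖ ^ 2) 0 t) := by
  have ht' : (t : ℂ) ≠ 0 := by exact_mod_cast ht.ne'
  have hsub : closedBall (0 : ℂ) t ⊆ ball 0 R := closedBall_subset_ball htR
  have hd : DiffContOnCl ℂ g (ball 0 t) :=
    (hg.mono (by rwa [closure_ball _ ht.ne'])).diffContOnCl
  have hcont : Continuous fun θ => g (circleMap 0 t θ) := by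
    refine hg.continuousOn.comp_continuous (continuous_circleMap 0 t) fun θ => hsub ?_
    exact circleMap_mem_closedBall _ ht.le _
  have hmem : MemLp (fun θ => g (circleMap 0 t θ)) 2 (volume.restrict (Ioc 0 (2 * Real.pi))) := by
    obtain ⟨M, hM⟩ := (isCompact_Icc (a := (0 : ℝ)) (b := 2 * Real.pi)).exists_bound_of_continuousOn
      hcont.continuousOn
    refine MemLp.of_bound hcont.aestronglyMeasurable M ?_
    filter_upwards [ae_restrict_mem measurableSet_Ioc] with θ hθ
    exact hM θ (Ioc_subset_Icc_self hθ)
  have key := hasSum_sq_fourierCoeffOn Real.two_pi_pos hmem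
  have hps := hd.hasFPowerSeriesOnBall (R := ⟨t, ht.le⟩) (by exact ht)
  have han : AnalyticAt ℂ g 0 :=
    hg.analyticAt (isOpen_ball.mem_nhds (mem_ball_self (ht.trans htR)))
  have hpeq := hps.hasFPowerSeriesAt.eq_formalMultilinearSeries han.hasFPowerSeriesAt
  have hnat : ∀ n : ℕ, fourierCoeffOn Real.two_pi_pos (fun θ => g (circleMap 0 t θ)) (n : ℤ) =
      iteratedDeriv n g 0 / (n.factorial : ℂ) * t ^ n := by
    intro n
    rw [fourierCoeffOn_circleMap g ht, Real.circleAverage_eq_circleIntegral ht.ne']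
    have h1 := cauchyPowerSeries_apply g 0 t n (t : ℂ)
    have h2 : (cauchyPowerSeries g 0 t n fun _ => (t : ℂ)) =
        iteratedDeriv n g 0 / (n.factorial : ℂ) * t ^ n := by
      have : cauchyPowerSeries g 0 t = _ := hpeq
      rw [this]
      simp [FormalMultilinearSeries.ofScalars]
    rw [← h2, h1]
    congr 2
    ext z
    simp
    ring
  have hneg : ∀ m : ℤ, m ∉ range ((↑) : ℕ → ℤ) →
      fourierCoeffOn Real.two_pi_pos (fun θ => g (circleMap 0 t θ)) m = 0 := by
    intro m hm
    obtain ⟨n, rfl⟩ : ∃ n : ℕ, m = -((n + 1 : ℕ) : ℤ) := by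
      refine ⟨(-m - 1).toNat, ?_⟩
      have : m < 0 := by
        by_contra h
        exact hm ⟨m.toNat, by simp; omega⟩
      omega
    rw [fourierCoeffOn_circleMap g ht]
    -- The coefficient of index `-(n+1)` is the mean of a holomorphic function vanishing at `0`.
    have hd2 : DiffContOnCl ℂ (fun z => (z / t) ^ (n + 1) * g z) (ball 0 |t|) := by
      rw [abs_of_pos ht]
      exact (by fun_prop : Differentiable ℂ fun z : ℂ => (z / t) ^ (n + 1)).diffContOnCl.smul hd
    have := hd2.circleAverage
    simp only [zero_div, ne_eq, Nat.add_eq_zero_iff, one_ne_zero, and_false, not_false_eq_true,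
      zero_pow, zero_mul] at this
    rw [← this]
    congr 1
    ext z
    rw [zpow_neg, zpow_natCast, ← inv_pow, inv_div]
  have key2 := (Function.Injective.hasSum_iff (f := fun i : ℤ =>
    ‖fourierCoeffOn Real.two_pi_pos (fun θ => g (circleMap 0 t θ)) i‖ ^ 2)
    (Nat.cast_injective (R := ℤ)) (fun m hm => by simp [hneg m hm])).2 key
  convert! key2 using 1
  · ext n
    simp only [Function.comp, hnat, norm_mul, norm_pow, Complex.norm_real, Real.norm_of_nonneg ht.le]
    ring
  · rw [Real.circleAverage_def, sub_zero]

/-! ### Area in polar coordinates. -/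

open Complex Metric Set MeasureTheory Filter Topology Real in
-- The interval from `-π` to `π` is the angular range of `Complex.polarCoord`.
theorem circleAverage_eq_integral_neg_pi_pi (F : ℂ → ℝ) (r : ℝ) :
    2 * Real.pi * Real.circleAverage F 0 r =
      ∫ θ in (-Real.pi)..Real.pi, F (circleMap 0 r θ) := by
  rw [Real.circleAverage_eq_integral_add (-Real.pi),
    intervalIntegral.integral_comp_add_right (fun θ => F (circleMap 0 r θ)), smul_eq_mul,
    mul_inv_cancel_left₀ (by positivity)]
  congr 1 <;> ring

/-- A lower bound for an integral over an annulus from lower bounds for its circle averages. -/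
theorem ofReal_integral_le_lintegral_annulus {F : ℂ → ℝ} {m : ℝ → ℝ} {ρ R : ℝ} (hρ : 0 ≤ ρ)
    (hρR : ρ ≤ R)
    (hF : ContinuousOn F {z | ρ < ‖z‖ ∧ ‖z‖ < R}) (hF0 : ∀ z, 0 ≤ F z)
    (hm : ∀ r ∈ Set.Ioo ρ R, m r ≤ Real.circleAverage F 0 r)
    (hmi : IntervalIntegrable (fun r => 2 * Real.pi * (r * m r)) MeasureTheory.volume ρ R)
    (hm0 : ∀ r ∈ Set.Ioo ρ R, 0 ≤ m r) :
    ENNReal.ofReal (∫ r in ρ..R, 2 * Real.pi * (r * m r)) ≤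
      ∫⁻ z in {z : ℂ | ρ < ‖z‖ ∧ ‖z‖ < R}, ENNReal.ofReal (F z) := by
  set A : Set ℂ := {z : ℂ | ρ < ‖z‖ ∧ ‖z‖ < R} with hA
  have hAo : IsOpen A := (isOpen_lt continuous_const continuous_norm).inter
    (isOpen_lt continuous_norm continuous_const)
  have hpolar : ∀ p : ℝ × ℝ, Complex.polarCoord.symm p = circleMap 0 p.1 p.2 := by
    intro p
    rw [Complex.polarCoord_symm_apply, circleMap_zero, Complex.exp_mul_I]
    push_cast
    rfl
  have hsub : Set.Ioo ρ R ×ˢ Set.Ioo (-Real.pi) Real.pi ⊆ Complex.polarCoord.target := by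
    rw [Complex.polarCoord_target]
    exact Set.prod_mono (fun r hr => hρ.trans_lt hr.1) subset_rfl
  have hcA : ∀ r ∈ Set.Ioo ρ R, ∀ θ, circleMap 0 r θ ∈ A := by
    intro r hr θ
    simp [hA, norm_circleMap_zero, abs_of_pos (hρ.trans_lt hr.1), hr.1, hr.2]
  have hcirc : ∀ r ∈ Set.Ioo ρ R, Continuous fun θ => F (circleMap 0 r θ) := fun r hr =>
    hF.comp_continuous (continuous_circleMap 0 r) (hcA r hr)
  have hjoint : ContinuousOn (fun p : ℝ × ℝ => F (circleMap 0 p.1 p.2))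
      (Set.Ioo ρ R ×ˢ Set.Ioo (-Real.pi) Real.pi) := by
    refine hF.comp (by unfold circleMap; fun_prop) ?_
    intro p hp
    exact hcA p.1 hp.1 p.2
  have hinner : ∀ r ∈ Set.Ioo ρ R, ENNReal.ofReal (2 * Real.pi * (r * m r)) ≤
      ∫⁻ θ in Set.Ioo (-Real.pi) Real.pi,
        ENNReal.ofReal r * ENNReal.ofReal (F (circleMap 0 r θ)) := by
    intro r hr
    have hr0 : 0 < r := hρ.trans_lt hr.1
    rw [MeasureTheory.lintegral_const_mul _ (hcirc r hr).measurable.ennreal_ofReal,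
      ← MeasureTheory.ofReal_integral_eq_lintegral_ofReal
        (((hcirc r hr).integrableOn_Icc).mono_set Set.Ioo_subset_Icc_self)
        (Filter.Eventually.of_forall fun θ => hF0 _),
      ← ENNReal.ofReal_mul hr0.le, ← MeasureTheory.integral_Ioc_eq_integral_Ioo,
      ← intervalIntegral.integral_of_le (by linarith [Real.pi_pos]),
      ← circleAverage_eq_integral_neg_pi_pi]
    refine ENNReal.ofReal_le_ofReal ?_
    have := hm r hr
    have h2 := mul_le_mul_of_nonneg_left this (by positivity : 0 ≤ 2 * Real.pi * r)
    linarith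
  calc ENNReal.ofReal (∫ r in ρ..R, 2 * Real.pi * (r * m r))
      = ∫⁻ r in Set.Ioo ρ R, ENNReal.ofReal (2 * Real.pi * (r * m r)) := by
        rw [intervalIntegral.integral_of_le hρR, MeasureTheory.integral_Ioc_eq_integral_Ioo,
          MeasureTheory.ofReal_integral_eq_lintegral_ofReal]
        · exact ((intervalIntegrable_iff_integrableOn_Ioc_of_le hρR).1 hmi).mono_set
            Set.Ioo_subset_Ioc_self
        · filter_upwards [MeasureTheory.ae_restrict_mem measurableSet_Ioo] with r hr
          have := hm0 r hr
          have := hρ.trans hr.1.le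
          positivity
    _ ≤ ∫⁻ r in Set.Ioo ρ R, ∫⁻ θ in Set.Ioo (-Real.pi) Real.pi,
          ENNReal.ofReal r * ENNReal.ofReal (F (circleMap 0 r θ)) :=
        MeasureTheory.setLIntegral_mono' measurableSet_Ioo hinner
    _ = ∫⁻ p in Set.Ioo ρ R ×ˢ Set.Ioo (-Real.pi) Real.pi,
          ENNReal.ofReal p.1 * ENNReal.ofReal (F (circleMap 0 p.1 p.2)) := by
        rw [MeasureTheory.Measure.volume_eq_prod, MeasureTheory.setLIntegral_prod]
        refine AEMeasurable.mul measurable_fst.ennreal_ofReal.aemeasurable ?_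
        exact (hjoint.aemeasurable (measurableSet_Ioo.prod measurableSet_Ioo)).ennreal_ofReal
    _ ≤ ∫⁻ p in Complex.polarCoord.target, ENNReal.ofReal p.1 •
          A.indicator (fun z => ENNReal.ofReal (F z)) (Complex.polarCoord.symm p) := by
        refine le_trans (le_of_eq ?_) (MeasureTheory.lintegral_mono_set hsub)
        refine MeasureTheory.setLIntegral_congr_fun (measurableSet_Ioo.prod measurableSet_Ioo) ?_
        intro p hp
        simp only [hpolar, smul_eq_mul, Set.indicator_of_mem (hcA p.1 hp.1 p.2)]
    _ = ∫⁻ z in A, ENNReal.ofReal (F z) := by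
        exact (Complex.lintegral_comp_polarCoord_symm _).trans
          (MeasureTheory.lintegral_indicator hAo.measurableSet _)

/-- The determinant of the real linear map `v ↦ a v + c v̄` of `ℂ`. -/
theorem det_mul_add_mul_conj (a c : ℂ) :
    ((a • (1 : ℂ →L[ℝ] ℂ)) + c • (Complex.conjCLE : ℂ →L[ℝ] ℂ)).det =
      ‖a‖ ^ 2 - ‖c‖ ^ 2 := by
  rw [ContinuousLinearMap.det, ← LinearMap.det_toMatrix Complex.basisOneI, Matrix.det_fin_two]
  simp [LinearMap.toMatrix_apply, Complex.sq_norm, Complex.normSq_apply]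
  ring

/-! ### The area theorem for one coefficient. -/

/-- The left side bounds the corrected image of a point of modulus `s`. For `s ≤ 2ρ` the remainder
in `C` is at most `8Cρ²`; for `s ≥ 2ρ` it is paid for by the gap between `ρ⁻¹` and `s⁻¹`. -/
theorem annulus_norm_bound {B C ρ s : ℝ} (hB : 0 ≤ B) (hC : 0 ≤ C) (hρ : 0 < ρ) (hρ1 : ρ ≤ 1)
    (hBρ : 4 * B * ρ ≤ 1) (hCρ : 8 * C * ρ ≤ 1) (hs : ρ ≤ s) (hs1 : s ≤ 1) :
    s⁻¹ + B * (s ^ 2 - ρ ^ 2) / s + B ^ 2 * ρ ^ 2 * s + (1 + B * ρ ^ 2) * (C * s ^ 2) ≤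
      ρ⁻¹ + (B ^ 2 + 8 * C) * ρ ^ 2 := by
  have hs0 : 0 < s := hρ.trans_le hs
  have h1 : B ^ 2 * ρ ^ 2 * s ≤ B ^ 2 * ρ ^ 2 := mul_le_of_le_one_right (by positivity) hs1
  have hBρ2 : B * ρ ^ 2 ≤ 1 := by nlinarith [mul_nonneg hB hρ.le]
  have h2 : (1 + B * ρ ^ 2) * (C * s ^ 2) ≤ 2 * (C * s ^ 2) := by
    have : 0 ≤ C * s ^ 2 := by positivity
    nlinarith
  have hfac : ρ⁻¹ - s⁻¹ - B * (s ^ 2 - ρ ^ 2) / s =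
      ((s - ρ) / s) * (ρ⁻¹ * (1 - B * ρ * (s + ρ))) := by
    field_simp
    ring
  have h3 : 1 / 2 ≤ 1 - B * ρ * (s + ρ) := by
    have : B * ρ * (s + ρ) ≤ B * ρ * 2 := by
      apply mul_le_mul_of_nonneg_left (by linarith) (by positivity)
    linarith
  have h4 : ρ⁻¹ * (1 / 2) ≤ ρ⁻¹ * (1 - B * ρ * (s + ρ)) :=
    mul_le_mul_of_nonneg_left h3 (by positivity)
  have h5 : 0 ≤ (s - ρ) / s := div_nonneg (by linarith) hs0.le
  suffices 2 * (C * s ^ 2) ≤ ((s - ρ) / s) * (ρ⁻¹ * (1 / 2)) + 8 * C * ρ ^ 2 by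
    have := mul_le_mul_of_nonneg_left h4 h5
    linarith
  rcases le_total s (2 * ρ) with h | h
  · have : s ^ 2 ≤ (2 * ρ) ^ 2 := pow_le_pow_left₀ hs0.le h 2
    have h7 : 0 ≤ ((s - ρ) / s) * (ρ⁻¹ * (1 / 2)) := by positivity
    nlinarith
  · have h6 : 1 / 2 ≤ (s - ρ) / s := by
      rw [le_div_iff₀ hs0]; linarith
    have h7 : (1 / 2) * (ρ⁻¹ * (1 / 2)) ≤ ((s - ρ) / s) * (ρ⁻¹ * (1 / 2)) :=
      mul_le_mul_of_nonneg_right h6 (by positivity)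
    have h8 : 8 * C ≤ ρ⁻¹ := by
      rw [← one_div, le_div_iff₀ hρ]; linarith
    have h9 : C * s ^ 2 ≤ C := mul_le_of_le_one_right hC (by nlinarith)
    have : 0 ≤ 8 * C * ρ ^ 2 := by positivity
    linarith

open Complex Metric Set MeasureTheory Filter Topology in
-- The second difference quotient of `φ` at `0` is holomorphic, hence bounded on a smaller closed
-- disk.
theorem exists_norm_sub_deriv_mul_le {φ : ℂ → ℂ} (hφ : DifferentiableOn ℂ φ (ball 0 1))
    (h0 : φ 0 = 0) {R : ℝ} (hR : R < 1) :
    ∃ C : ℝ, 0 ≤ C ∧ ∀ z, ‖z‖ ≤ R → ‖φ z - deriv φ 0 * z‖ ≤ C * ‖z‖ ^ 2 := by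
  have hb : ball (0 : ℂ) 1 ∈ 𝓝 0 := isOpen_ball.mem_nhds (mem_ball_self one_pos)
  set g := dslope (dslope φ 0) 0
  have hg : DifferentiableOn ℂ g (ball 0 1) :=
    (differentiableOn_dslope hb).2 ((differentiableOn_dslope hb).2 hφ)
  obtain ⟨C, hC⟩ := (isCompact_closedBall (0 : ℂ) R).exists_bound_of_continuousOn
    (hg.continuousOn.mono (closedBall_subset_ball hR))
  refine ⟨max C 0, le_max_right _ _, fun z hz => ?_⟩
  have e : φ z - deriv φ 0 * z = z ^ 2 * g z := by
    have h1 := sub_smul_dslope φ 0 z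
    have h2 := sub_smul_dslope (dslope φ 0) 0 z
    simp only [sub_zero, smul_eq_mul, h0, dslope_same] at h1 h2
    rw [pow_two, mul_assoc, h2, mul_sub, h1]
    ring
  rw [e, norm_mul, norm_pow, mul_comm]
  gcongr
  exact (hC z (by simpa using hz)).trans (le_max_left _ _)

open Complex Metric Set MeasureTheory Filter Topology in
-- Multiplication by `z²` makes the function holomorphic; Parseval is then truncated to the
-- coefficients of index `0` and `2`.
theorem le_circleAverage_sq_norm_neg_inv_sq_add_deriv {φ : ℂ → ℂ}
    (hφ : DifferentiableOn ℂ φ (ball 0 1)) {r : ℝ} (hr : 0 < r) (hr1 : r < 1) :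
    (r ^ 4)⁻¹ + ‖deriv φ 0‖ ^ 2 ≤
      Real.circleAverage (fun z => ‖-(z ^ 2)⁻¹ + deriv φ z‖ ^ 2) 0 r := by
  set ψ := deriv φ
  have hψ : DifferentiableOn ℂ ψ (ball 0 1) := hφ.deriv isOpen_ball
  set k : ℂ → ℂ := fun z => -1 + z ^ 2 * ψ z with hk
  have hkd : DifferentiableOn ℂ k (ball 0 1) := by
    have : DifferentiableOn ℂ (fun z : ℂ => z ^ 2) (ball 0 1) := by fun_prop
    exact (this.mul hψ).const_add _
  have hψat : ∀ z ∈ ball (0 : ℂ) 1, HasDerivAt ψ (deriv ψ z) z := fun z hz =>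
    (hψ.differentiableAt (isOpen_ball.mem_nhds hz)).hasDerivAt
  have h0mem : (0 : ℂ) ∈ ball (0 : ℂ) 1 := mem_ball_self one_pos
  have hk1 : deriv k =ᶠ[𝓝 0] fun z => z * (2 * ψ z + z * deriv ψ z) := by
    filter_upwards [isOpen_ball.mem_nhds h0mem] with z hz
    have := (((hasDerivAt_pow 2 z).mul (hψat z hz)).const_add (-1))
    refine (this.deriv).trans ?_
    simp
    ring
  have hk2 : iteratedDeriv 2 k 0 = 2 * ψ 0 := by
    rw [iteratedDeriv_succ, iteratedDeriv_one, hk1.deriv_eq]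
    have hd : DifferentiableAt ℂ (fun z => 2 * ψ z + z * deriv ψ z) 0 := by
      have h1 := (hψat 0 h0mem).differentiableAt
      have h2 := (hψ.deriv isOpen_ball).differentiableAt (isOpen_ball.mem_nhds h0mem)
      fun_prop
    have := ((hasDerivAt_id (0 : ℂ)).mul hd.hasDerivAt).deriv
    refine (this).trans ?_
    simp
  have hp := hasSum_sq_taylorCoeff_circleAverage hkd hr hr1
  have hle := sum_le_hasSum {0, 2} (fun i _ => by positivity) hp
  rw [Finset.sum_pair (by norm_num), hk2] at hle
  simp only [iteratedDeriv_zero, hk] at hle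
  norm_num [Nat.factorial] at hle
  have hcongr : Real.circleAverage (fun z => ‖-(z ^ 2)⁻¹ + ψ z‖ ^ 2) 0 r =
      (r ^ 4)⁻¹ * Real.circleAverage (fun z => ‖k z‖ ^ 2) 0 r := by
    rw [← smul_eq_mul, ← Real.circleAverage_fun_smul]
    refine Real.circleAverage_congr_sphere fun z hz => ?_
    have hz' : ‖z‖ = r := by simpa [abs_of_pos hr] using hz
    have hz0 : z ≠ 0 := by
      rw [← norm_pos_iff, hz']; exact hr
    have : k z = z ^ 2 * (-(z ^ 2)⁻¹ + ψ z) := by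
      simp only [hk]; field_simp
    simp only [this, norm_mul, norm_pow, hz', smul_eq_mul]
    field_simp
  rw [hcongr]
  have hr4 : 0 < r ^ 4 := by positivity
  have := mul_le_mul_of_nonneg_left hle (inv_nonneg.2 hr4.le)
  refine le_trans (le_of_eq ?_) this
  field_simp

open Complex Metric Set MeasureTheory Filter Topology in
/-- Comparison of the area of the image of an annulus under `z ↦ z⁻¹ + φ z`, corrected by the
real linear map `w ↦ w - b ρ² w̄`, with the area of a disk containing it. -/
theorem annulus_area_inequality {φ : ℂ → ℂ} (hφ : DifferentiableOn ℂ φ (ball 0 1))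
    (hinj : InjOn (fun z => z⁻¹ + φ z) (ball 0 1 \ {0})) {C ρ R : ℝ}
    (hC : 0 ≤ C) (hR : R < 1)
    (hφC : ∀ z, ‖z‖ ≤ R → ‖φ z - deriv φ 0 * z‖ ≤ C * ‖z‖ ^ 2) (hρ : 0 < ρ) (hρR : ρ ≤ R)
    (hBρ : 4 * ‖deriv φ 0‖ * ρ ≤ 1) (hCρ : 8 * C * ρ ≤ 1) :
    (1 - ‖deriv φ 0‖ ^ 2 * ρ ^ 4) *
        ((ρ ^ 2)⁻¹ - (R ^ 2)⁻¹ + ‖deriv φ 0‖ ^ 2 * (R ^ 2 - ρ ^ 2)) ≤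
      (ρ⁻¹ + (‖deriv φ 0‖ ^ 2 + 8 * C) * ρ ^ 2) ^ 2 := by
  set b := deriv φ 0 with hb
  set c : ℂ := b * (ρ : ℂ) ^ 2 with hc
  have hρ1 : ρ ≤ 1 := by linarith
  have hcn : ‖c‖ = ‖b‖ * ρ ^ 2 := by simp [hc]
  have hc1 : ‖c‖ < 1 := by
    rw [hcn]; nlinarith [norm_nonneg b, mul_nonneg (norm_nonneg b) hρ.le]
  set κ : ℝ := 1 - ‖b‖ ^ 2 * ρ ^ 4 with hκ
  have hκc : κ = 1 - ‖c‖ ^ 2 := by rw [hcn, hκ]; ring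
  have hκ0 : 0 ≤ κ := by rw [hκc]; nlinarith [norm_nonneg c]
  set A : Set ℂ := {z : ℂ | ρ < ‖z‖ ∧ ‖z‖ < R} with hA
  have hAo : IsOpen A := (isOpen_lt continuous_const continuous_norm).inter
    (isOpen_lt continuous_norm continuous_const)
  have hAball : A ⊆ ball 0 1 \ {0} := by
    intro z hz
    refine ⟨by simpa using hz.2.trans hR, ?_⟩
    have := norm_pos_iff.1 (hρ.trans hz.1)
    simpa using this
  set g : ℂ → ℂ := fun z => z⁻¹ + φ z with hg
  set g' : ℂ → ℂ := fun z => -(z ^ 2)⁻¹ + deriv φ z with hg'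
  have hgd : ∀ z ∈ A, HasDerivAt g (g' z) z := by
    intro z hz
    have hz2 := hAball hz
    exact (hasDerivAt_inv hz2.2).add
      (hφ.differentiableAt (isOpen_ball.mem_nhds hz2.1)).hasDerivAt
  -- The map `z ↦ z⁻¹ + b z` sends `|z| = ρ` to an ellipse with semi-axes `ρ⁻¹ ± |b|ρ`, and `T`
  -- rounds it up to higher order. Without `T`, the area of the covering disk would exceed `πρ⁻²` by
  -- about `2π|b|`, which does not vanish as `ρ → 0`.
  set T : ℂ → ℂ := fun w => w - c * (starRingEnd ℂ) w with hT
  have hTinj : Function.Injective T := by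
    intro v w hvw
    have h1 : v - w = c * (starRingEnd ℂ) (v - w) := by
      simp only [hT] at hvw
      rw [map_sub]
      linear_combination hvw
    have h2 : ‖v - w‖ = ‖c‖ * ‖v - w‖ := by
      conv_lhs => rw [h1]
      rw [norm_mul, RCLike.norm_conj]
    have h3 : ‖v - w‖ = 0 := by nlinarith [norm_nonneg (v - w)]
    exact sub_eq_zero.1 (norm_eq_zero.1 h3)
  set M : ℝ := ρ⁻¹ + (‖b‖ ^ 2 + 8 * C) * ρ ^ 2 with hM
  have hM0 : 0 ≤ M := by positivity
  have hTg : ∀ z ∈ A, ‖T (g z)‖ ≤ M := by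
    intro z hz
    have hz0 : z ≠ 0 := (hAball hz).2
    have hzn : 0 < ‖z‖ := norm_pos_iff.2 hz0
    have hzr : ρ ^ 2 ≤ ‖z‖ ^ 2 := pow_le_pow_left₀ hρ.le hz.1.le 2
    have hconj0 : (starRingEnd ℂ) z ≠ 0 := by simpa using hz0
    -- Since `z = |z|² / z̄`, the terms `b z` and `bρ² / z̄` combine into one with factor `|z|² -
    -- ρ²`, small near the outer boundary of the image.
    have hdecomp : T (g z) = z⁻¹ + ((b * ((‖z‖ ^ 2 - ρ ^ 2 : ℝ) : ℂ)) * ((starRingEnd ℂ) z)⁻¹) -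
        c * (starRingEnd ℂ) (b * z) + T (φ z - b * z) := by
      have e1 : z = (‖z‖ : ℂ) ^ 2 * ((starRingEnd ℂ) z)⁻¹ := by
        rw [eq_mul_inv_iff_mul_eq₀ hconj0, Complex.mul_conj']
      have e2 : b * z = b * ((‖z‖ : ℂ) ^ 2 * ((starRingEnd ℂ) z)⁻¹) := by rw [← e1]
      simp only [hT, hg, map_add, map_sub, map_inv₀, hc]
      push_cast
      linear_combination e2
    have hTn : ∀ w, ‖T w‖ ≤ (1 + ‖b‖ * ρ ^ 2) * ‖w‖ := by
      intro w
      refine (norm_sub_le _ _).trans ?_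
      rw [norm_mul, RCLike.norm_conj, hcn]
      linarith
    have hrem := (hTn (φ z - b * z)).trans (mul_le_mul_of_nonneg_left (hφC z hz.2.le)
      (by positivity))
    have hbound := annulus_norm_bound (norm_nonneg b) hC hρ hρ1 hBρ hCρ hz.1.le
      (hz.2.le.trans hR.le)
    rw [hdecomp]
    refine ((norm_add_le _ _).trans (add_le_add ((norm_sub_le _ _).trans (add_le_add
      (norm_add_le _ _) le_rfl)) hrem)).trans (le_trans (le_of_eq ?_) hbound)
    rw [norm_mul c, hcn, norm_mul, norm_mul, norm_inv, norm_inv, RCLike.norm_conj,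
      RCLike.norm_conj, norm_mul, Complex.norm_real, Real.norm_of_nonneg (by linarith)]
    ring
  have hfd : ∀ z ∈ A, HasFDerivWithinAt (fun z => T (g z))
      ((g' z • (1 : ℂ →L[ℝ] ℂ)) + (-(c * (starRingEnd ℂ) (g' z))) • (conjCLE : ℂ →L[ℝ] ℂ)) A z := by
    intro z hz
    have h1 := (hgd z hz).complexToReal_fderiv
    have h2 := (conjCLE : ℂ →L[ℝ] ℂ).hasFDerivAt.comp z h1
    have h3 := h1.sub (h2.const_mul c)
    refine (h3.congr_fderiv ?_).hasFDerivWithinAt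
    ext <;> simp <;> ring
  have hvol := lintegral_abs_det_fderiv_eq_addHaar_image volume hAo.measurableSet hfd
    (hTinj.comp_injOn (hinj.mono hAball))
  have hdet : ∀ z, ((g' z • (1 : ℂ →L[ℝ] ℂ)) +
      (-(c * (starRingEnd ℂ) (g' z))) • (conjCLE : ℂ →L[ℝ] ℂ)).det = κ * ‖g' z‖ ^ 2 := by
    intro z
    rw [det_mul_add_mul_conj, norm_neg, norm_mul, RCLike.norm_conj, hκc]
    ring
  simp only [hdet] at hvol
  have hle : volume ((fun z => T (g z)) '' A) ≤ ENNReal.ofReal (Real.pi * M ^ 2) := by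
    refine (measure_mono (t := closedBall 0 M) ?_).trans (le_of_eq ?_)
    · rintro _ ⟨z, hz, rfl⟩
      simpa using hTg z hz
    · rw [Complex.volume_closedBall, mul_comm, ENNReal.ofReal_mul Real.pi_pos.le,
        ENNReal.ofReal_pow hM0, ← NNReal.coe_real_pi, ENNReal.ofReal_coe_nnreal]
  have hcont : ContinuousOn (fun z => κ * ‖g' z‖ ^ 2) A := by
    have h1 : ContinuousOn (deriv φ) A :=
      (hφ.deriv isOpen_ball).continuousOn.mono (hAball.trans sdiff_subset)
    have h2 : ContinuousOn (fun z : ℂ => (z ^ 2)⁻¹) A :=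
      ContinuousOn.inv₀ (by fun_prop) fun z hz => pow_ne_zero 2 (hAball hz).2
    have h3 : ContinuousOn g' A := h2.neg.add h1
    exact continuousOn_const.mul (h3.norm.pow 2)
  have hcontm : ContinuousOn (fun r : ℝ => 2 * Real.pi * (r * (κ * ((r ^ 4)⁻¹ + ‖b‖ ^ 2))))
      (uIcc ρ R) := by
    have h2 : ContinuousOn (fun r : ℝ => (r ^ 4)⁻¹) (uIcc ρ R) :=
      ContinuousOn.inv₀ (by fun_prop) fun r hr => by
        rw [uIcc_of_le hρR] at hr
        exact pow_ne_zero 4 (hρ.trans_le hr.1).ne'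
    exact continuousOn_const.mul (continuousOn_id.mul (continuousOn_const.mul
      (h2.add continuousOn_const)))
  have hlow := ofReal_integral_le_lintegral_annulus (F := fun z => κ * ‖g' z‖ ^ 2)
    (m := fun r => κ * ((r ^ 4)⁻¹ + ‖b‖ ^ 2)) hρ.le hρR hcont (fun z => by positivity)
    (fun r hr => by
      have := le_circleAverage_sq_norm_neg_inv_sq_add_deriv hφ (hρ.trans hr.1) (hr.2.trans hR)
      simp only [← smul_eq_mul κ, Real.circleAverage_fun_smul]
      exact mul_le_mul_of_nonneg_left this hκ0)
    hcontm.intervalIntegrable (fun r hr => by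
      have := hρ.trans hr.1
      positivity)
  have hint : ∫ r in ρ..R, 2 * Real.pi * (r * (κ * ((r ^ 4)⁻¹ + ‖b‖ ^ 2))) =
      Real.pi * κ * ((ρ ^ 2)⁻¹ - (R ^ 2)⁻¹ + ‖b‖ ^ 2 * (R ^ 2 - ρ ^ 2)) := by
    rw [intervalIntegral.integral_eq_sub_of_hasDerivAt
      (f := fun r => Real.pi * κ * (-(r ^ 2)⁻¹ + ‖b‖ ^ 2 * r ^ 2)) ?_ hcontm.intervalIntegrable]
    · ring
    · intro r hr
      rw [uIcc_of_le hρR] at hr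
      have hr0 : r ≠ 0 := (hρ.trans_le hr.1).ne'
      have h1 := ((hasDerivAt_pow 2 r).inv (pow_ne_zero 2 hr0)).neg
      have h2 := (hasDerivAt_pow 2 r).const_mul (‖b‖ ^ 2)
      refine ((h1.add h2).const_mul (Real.pi * κ)).congr_deriv ?_
      field_simp
      norm_num
      ring
  have hfin := (hlow.trans_eq ((lintegral_congr fun z => by
    rw [abs_of_nonneg (by positivity)]).trans hvol)).trans hle
  rw [hint, ENNReal.ofReal_le_ofReal_iff (by positivity), mul_assoc] at hfin
  exact le_of_mul_le_mul_left hfin Real.pi_pos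

open Complex Metric Set MeasureTheory Filter Topology in
/-- The case of one coefficient of Gronwall's area theorem. -/
theorem norm_deriv_le_one_of_injOn_inv_add {φ : ℂ → ℂ} (hφ : DifferentiableOn ℂ φ (ball 0 1))
    (h0 : φ 0 = 0) (hinj : InjOn (fun z => z⁻¹ + φ z) (ball 0 1 \ {0})) :
    ‖deriv φ 0‖ ≤ 1 := by
  set B := ‖deriv φ 0‖ with hB
  have hmain : ∀ R : ℝ, 0 < R → R < 1 → B ^ 2 * R ^ 2 - (R ^ 2)⁻¹ ≤ 0 := by
    intro R hR0 hR
    obtain ⟨C, hC, hφC⟩ := exists_norm_sub_deriv_mul_le hφ h0 hR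
    set K := B ^ 2 + 8 * C with hK
    have hcL : Tendsto (fun ρ : ℝ => -B ^ 2 * ρ ^ 2 + (1 - B ^ 2 * ρ ^ 4) *
        (B ^ 2 * (R ^ 2 - ρ ^ 2) - (R ^ 2)⁻¹)) (𝓝[>] 0) (𝓝 (B ^ 2 * R ^ 2 - (R ^ 2)⁻¹)) := by
      refine Tendsto.mono_left ?_ nhdsWithin_le_nhds
      refine Continuous.tendsto' (by fun_prop) _ _ ?_
      ring
    have hcR : Tendsto (fun ρ : ℝ => 2 * K * ρ + K ^ 2 * ρ ^ 4) (𝓝[>] 0) (𝓝 0) := by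
      refine Tendsto.mono_left ?_ nhdsWithin_le_nhds
      refine Continuous.tendsto' (by fun_prop) _ _ ?_
      ring
    refine le_of_tendsto_of_tendsto hcL hcR ?_
    have e1 : ∀ᶠ ρ : ℝ in 𝓝[>] 0, 4 * B * ρ < 1 :=
      Tendsto.eventually_lt_const (by norm_num : (0 : ℝ) < 1)
        ((Continuous.tendsto' (by fun_prop) _ _ (by ring)).mono_left nhdsWithin_le_nhds)
    have e2 : ∀ᶠ ρ : ℝ in 𝓝[>] 0, 8 * C * ρ < 1 :=
      Tendsto.eventually_lt_const (by norm_num : (0 : ℝ) < 1)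
        ((Continuous.tendsto' (by fun_prop) _ _ (by ring)).mono_left nhdsWithin_le_nhds)
    filter_upwards [e1, e2, Ioo_mem_nhdsGT hR0] with ρ h1 h2 h3
    have := annulus_area_inequality hφ hinj hC hR hφC h3.1 h3.2.le h1.le h2.le
    rw [← hB] at this
    have hρ0 : ρ ≠ 0 := h3.1.ne'
    -- The divergent `ρ⁻²` terms on the two sides cancel, so the limit `ρ → 0` is finite.
    have x1 : (1 - B ^ 2 * ρ ^ 4) * (ρ ^ 2)⁻¹ = (ρ ^ 2)⁻¹ - B ^ 2 * ρ ^ 2 := by field_simp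
    have x2 : (ρ⁻¹ + K * ρ ^ 2) ^ 2 = (ρ ^ 2)⁻¹ + 2 * K * ρ + K ^ 2 * ρ ^ 4 := by
      field_simp
      ring
    rw [x2] at this
    linear_combination this - x1
  have hlim : Tendsto (fun R : ℝ => B ^ 2 * R ^ 2 - (R ^ 2)⁻¹) (𝓝[<] 1) (𝓝 (B ^ 2 - 1)) := by
    refine Tendsto.mono_left ?_ nhdsWithin_le_nhds
    have : ContinuousAt (fun R : ℝ => B ^ 2 * R ^ 2 - (R ^ 2)⁻¹) 1 := by
      fun_prop (disch := norm_num)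
    simpa [ContinuousAt] using this
  have := le_of_tendsto hlim (by
    filter_upwards [Ioo_mem_nhdsLT (zero_lt_one' ℝ)] with R hR using hmain R hR.1 hR.2)
  nlinarith [norm_nonneg (deriv φ 0)]

/-! ### Square root transform and Bieberbach's bound. -/

open Complex Metric Set Filter Topology in
-- The root is `exp (L / 2)`, where `L` is a primitive of `F' / F` on the disk; `F exp (-L)` has
-- zero derivative.
theorem exists_differentiableOn_sq_eq {F : ℂ → ℂ} (hF : DifferentiableOn ℂ F (ball 0 1))
    (hF0 : ∀ z ∈ ball (0 : ℂ) 1, F z ≠ 0) (h1 : F 0 = 1) :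
    ∃ k : ℂ → ℂ, DifferentiableOn ℂ k (ball 0 1) ∧ k 0 = 1 ∧ ∀ z ∈ ball (0 : ℂ) 1, k z ^ 2 = F z := by
  have hd : DifferentiableOn ℂ (fun z => deriv F z / F z) (ball 0 1) :=
    (hF.deriv isOpen_ball).div hF hF0
  obtain ⟨L, hL0, hL⟩ := hd.isExactOn_ball.with_val_at 0 0
  have h0 : (0 : ℂ) ∈ ball (0 : ℂ) 1 := mem_ball_self one_pos
  have hder : ∀ z ∈ ball (0 : ℂ) 1, HasDerivAt (fun z => F z * exp (-L z)) 0 z := by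
    intro z hz
    have h2 := (hF.differentiableAt (isOpen_ball.mem_nhds hz)).hasDerivAt.mul (hL z hz).neg.cexp
    refine h2.congr_deriv ?_
    have := hF0 z hz
    field_simp
    ring
  have hconst : ∀ z ∈ ball (0 : ℂ) 1, F z * exp (-L z) = 1 := by
    intro z hz
    have := isOpen_ball.is_const_of_deriv_eq_zero (convex_ball (0 : ℂ) 1).isPreconnected
      (fun z hz => (hder z hz).differentiableAt.differentiableWithinAt)
      (fun z hz => (hder z hz).deriv) hz h0
    simpa [h1, hL0] using this
  refine ⟨fun z => exp (L z / 2), fun z hz => ?_, by simp [hL0], fun z hz => ?_⟩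
  · exact ((hL z hz).div_const 2).cexp.differentiableAt.differentiableWithinAt
  · rw [← Complex.exp_nat_mul]
    have h3 := hconst z hz
    rw [Complex.exp_neg, mul_inv_eq_one₀ (exp_ne_zero _)] at h3
    rw [h3]
    congr 1
    push_cast
    ring

open Complex Metric Set Filter Topology in
theorem ne_zero_of_injOn_mul {F : ℂ → ℂ} (h1 : F 0 = 1)
    (hinj : InjOn (fun z => z * F z) (ball 0 1)) : ∀ z ∈ ball (0 : ℂ) 1, F z ≠ 0 := by
  intro z hz hFz
  have := hinj hz (mem_ball_self one_pos) (by simp [hFz])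
  rw [this, h1] at hFz
  exact one_ne_zero hFz

open Complex Metric Set in
theorem sq_mem_ball_zero_one {z : ℂ} (hz : z ∈ ball (0 : ℂ) 1) : z ^ 2 ∈ ball (0 : ℂ) 1 := by
  rw [mem_ball_zero_iff] at *
  rw [norm_pow]
  exact pow_lt_one₀ (norm_nonneg z) hz two_ne_zero

open Complex Metric Set Filter Topology in
/-- The square root transform of an injective function is injective. -/
theorem injOn_mul_comp_sq {F k : ℂ → ℂ} (hinj : InjOn (fun z => z * F z) (ball 0 1))
    (hk : ∀ z ∈ ball (0 : ℂ) 1, k z ^ 2 = F z) (hk0 : ∀ z ∈ ball (0 : ℂ) 1, k z ≠ 0) :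
    InjOn (fun z => z * k (z ^ 2)) (ball 0 1) := by
  intro a ha b hb hab
  have ha2 := sq_mem_ball_zero_one ha
  have hb2 := sq_mem_ball_zero_one hb
  have h2 : a ^ 2 = b ^ 2 := by
    refine hinj ha2 hb2 ?_
    simp only at hab ⊢
    rw [← hk _ ha2, ← hk _ hb2, ← mul_pow, ← mul_pow, hab]
  -- With `a² = b²` the nonzero factor `k (b²)` is common to both sides, which excludes `a = -b`
  -- unless `a = b`.
  simp only [h2] at hab
  exact mul_right_cancel₀ (hk0 _ hb2) hab

open Complex Metric Set Filter Topology in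
/-- Bieberbach's bound for the second coefficient of a normalized univalent function. -/
theorem norm_deriv_le_two_of_injOn_mul {F : ℂ → ℂ} (hF : DifferentiableOn ℂ F (ball 0 1))
    (h1 : F 0 = 1) (hinj : InjOn (fun z => z * F z) (ball 0 1)) : ‖deriv F 0‖ ≤ 2 := by
  have h0 : (0 : ℂ) ∈ ball (0 : ℂ) 1 := mem_ball_self one_pos
  have hF0 := ne_zero_of_injOn_mul h1 hinj
  obtain ⟨k, hkd, hk1, hk⟩ := exists_differentiableOn_sq_eq hF hF0 h1
  have hk0 : ∀ z ∈ ball (0 : ℂ) 1, k z ≠ 0 := by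
    intro z hz h
    exact hF0 z hz (by rw [← hk z hz, h]; simp)
  -- The reciprocal of the square root transform is `z⁻¹ + z ψ(z²)`, the form required by the area
  -- theorem, with coefficient `ψ 0 = -k'(0) = -F'(0)/2`.
  set ψ := dslope (fun w => (k w)⁻¹) 0
  have hψ : DifferentiableOn ℂ ψ (ball 0 1) :=
    (differentiableOn_dslope (isOpen_ball.mem_nhds h0)).2 (hkd.inv hk0)
  have hψ2 : DifferentiableOn ℂ (fun z => ψ (z ^ 2)) (ball 0 1) :=
    hψ.comp (by fun_prop) fun z hz => sq_mem_ball_zero_one hz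
  have hφ : DifferentiableOn ℂ (fun z => z * ψ (z ^ 2)) (ball 0 1) := differentiableOn_id.mul hψ2
  have heq : ∀ z ∈ ball (0 : ℂ) 1 \ {0}, z⁻¹ + z * ψ (z ^ 2) = (z * k (z ^ 2))⁻¹ := by
    intro z hz
    have hz0 : z ≠ 0 := hz.2
    have h2 := sub_smul_dslope (fun w => (k w)⁻¹) 0 (z ^ 2)
    simp only [sub_zero, smul_eq_mul, hk1, inv_one] at h2
    have h3 : z * ψ (z ^ 2) = z⁻¹ * (z ^ 2 * ψ (z ^ 2)) := by field_simp
    rw [h3, h2, mul_inv]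
    ring
  have hA := norm_deriv_le_one_of_injOn_inv_add hφ (by simp) (by
    intro a ha b hb hab
    simp only at hab
    rw [heq a ha, heq b hb] at hab
    exact injOn_mul_comp_sq hinj hk hk0 ha.1 hb.1 (inv_injective hab))
  have hkat := (hkd.differentiableAt (isOpen_ball.mem_nhds h0)).hasDerivAt
  have hd1 : deriv (fun z => z * ψ (z ^ 2)) 0 = -deriv k 0 := by
    have h4 := (hψ2.differentiableAt (isOpen_ball.mem_nhds h0)).hasDerivAt
    have h5 := ((hasDerivAt_id (0 : ℂ)).mul h4).deriv
    have h6 : ψ 0 = -deriv k 0 := by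
      have := (hkat.inv (hk0 0 h0)).deriv
      simp only [ψ, dslope_same]
      refine this.trans ?_
      simp [hk1]
    refine h5.trans ?_
    simp [h6]
  have hd2 : deriv F 0 = 2 * deriv k 0 := by
    have h7 : F =ᶠ[𝓝 0] fun z => k z ^ 2 := by
      filter_upwards [isOpen_ball.mem_nhds h0] with z hz using (hk z hz).symm
    rw [h7.deriv_eq]
    refine (hkat.pow 2).deriv.trans ?_
    simp [hk1]
  rw [hd1, norm_neg] at hA
  rw [hd2, norm_mul, Complex.norm_two]
  linarith

/-! ### The quarter theorem. -/

open Complex Metric Set Filter Topology in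
-- With `f = z F`, the function `w f / (w - f)` is again normalized and univalent, and its second
-- coefficient exceeds that of `f` by `w⁻¹`. Bieberbach's bound for both gives `|w⁻¹| ≤ 4`.
theorem one_le_four_mul_norm_of_notMem {F : ℂ → ℂ} (hF : DifferentiableOn ℂ F (ball 0 1))
    (h1 : F 0 = 1) (hinj : InjOn (fun z => z * F z) (ball 0 1)) {w : ℂ}
    (hw : ∀ z ∈ ball (0 : ℂ) 1, z * F z ≠ w) : 1 ≤ 4 * ‖w‖ := by
  have h0 : (0 : ℂ) ∈ ball (0 : ℂ) 1 := mem_ball_self one_pos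
  have hw0 : w ≠ 0 := fun h => hw 0 h0 (by simp [h])
  have hwF : ∀ z ∈ ball (0 : ℂ) 1, w - z * F z ≠ 0 := fun z hz h =>
    hw z hz (sub_eq_zero.1 h).symm
  have hzF : DifferentiableOn ℂ (fun z => z * F z) (ball 0 1) := differentiableOn_id.mul hF
  set G : ℂ → ℂ := fun z => w * F z / (w - z * F z) with hG
  have hGd : DifferentiableOn ℂ G (ball 0 1) := (hF.const_mul w).div (hzF.const_sub w) hwF
  have hG1 : G 0 = 1 := by simp [hG, h1, hw0]
  have hGinj : InjOn (fun z => z * G z) (ball 0 1) := by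
    intro a ha b hb hab
    refine hinj ha hb ?_
    have ha' := hwF a ha
    have hb' := hwF b hb
    simp only [hG] at hab ⊢
    field_simp at hab
    have : w * (a * F a - b * F b) = 0 := by linear_combination hab
    exact sub_eq_zero.1 ((mul_eq_zero.1 this).resolve_left hw0)
  have hFat := (hF.differentiableAt (isOpen_ball.mem_nhds h0)).hasDerivAt
  have hGder : deriv G 0 = deriv F 0 + w⁻¹ := by
    have h2 := (hFat.const_mul w).div (((hasDerivAt_id (0 : ℂ)).mul hFat).const_sub w) (hwF 0 h0)
    refine h2.deriv.trans ?_
    simp [h1]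
    field_simp
  have hb1 := norm_deriv_le_two_of_injOn_mul hF h1 hinj
  have hb2 := norm_deriv_le_two_of_injOn_mul hGd hG1 hGinj
  have h3 : ‖w‖⁻¹ ≤ 4 := by
    rw [← norm_inv]
    have : w⁻¹ = deriv G 0 - deriv F 0 := by rw [hGder]; ring
    rw [this]
    exact (norm_sub_le _ _).trans (by linarith)
  rw [inv_le_iff_one_le_mul₀ (norm_pos_iff.2 hw0)] at h3
  linarith

open Complex Metric Set Filter Topology in
/-- The Koebe quarter theorem. -/
theorem norm_deriv_le_four_mul_norm_sub_of_notMem {f : ℂ → ℂ}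
    (hf : DifferentiableOn ℂ f (ball 0 1)) (hinj : InjOn f (ball 0 1)) {w : ℂ}
    (hw : w ∉ f '' ball 0 1) : ‖deriv f 0‖ ≤ 4 * ‖w - f 0‖ := by
  have h0 : (0 : ℂ) ∈ ball (0 : ℂ) 1 := mem_ball_self one_pos
  by_cases ha : deriv f 0 = 0
  · simp [ha]
  set a := deriv f 0 with ha_def
  have hzF : ∀ z, z * (dslope f 0 z / a) = (f z - f 0) / a := by
    intro z
    have := sub_smul_dslope f 0 z
    simp only [sub_zero, smul_eq_mul] at this
    rw [← mul_div_assoc, this]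
  have := one_le_four_mul_norm_of_notMem (F := fun z => dslope f 0 z / a) (w := (w - f 0) / a)
    (((differentiableOn_dslope (isOpen_ball.mem_nhds h0)).2 hf).div_const a)
    (by simp [← ha_def, ha])
    (by
      intro x hx y hy hxy
      simp only [hzF] at hxy
      rw [div_left_inj' ha, sub_left_inj] at hxy
      exact hinj hx hy hxy)
    (by
      intro z hz h
      rw [hzF, div_left_inj' ha, sub_left_inj] at h
      exact hw ⟨z, hz, h⟩)
  rw [norm_div, ← mul_div_assoc, le_div_iff₀ (norm_pos_iff.2 ha)] at this
  linarith

/-! ### Growth and logarithmic derivative bounds. -/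

open Complex Metric Set Filter Topology in
-- Halving the principal argument puts it strictly between `-π/2` and `π/2`.
theorem re_exp_half_log_pos {v : ℂ} (hv : v ∈ slitPlane) : 0 < (exp (log v / 2)).re := by
  rw [Complex.exp_re]
  refine mul_pos (Real.exp_pos _) (Real.cos_pos_of_mem_Ioo ?_)
  have h1 := Complex.neg_pi_lt_arg v
  have h2 := (Complex.arg_le_pi v).lt_of_ne (Complex.mem_slitPlane_iff_arg.1 hv).1
  have h3 : (log v / 2).im = v.arg / 2 := by
    rw [show (2 : ℂ) = ((2 : ℝ) : ℂ) by norm_num, Complex.div_ofReal_im, Complex.log_im]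
  rw [h3]
  constructor <;> linarith

open Complex Metric Set Filter Topology in
theorem re_one_sub_div_one_add_pos {z : ℂ} (hz : z ∈ ball (0 : ℂ) 1) :
    0 < ((1 - z) / (1 + z)).re := by
  have hz1 : ‖z‖ < 1 := by simpa using hz
  have h1 : (1 : ℂ) + z ≠ 0 := by
    intro h
    have : ‖z‖ = 1 := by rw [show z = -1 by linear_combination h]; simp
    linarith
  have h2 : normSq z < 1 := by
    rw [Complex.normSq_eq_norm_sq]
    exact pow_lt_one₀ (norm_nonneg z) hz1 two_ne_zero
  rw [Complex.div_re, ← add_div]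
  refine div_pos ?_ (Complex.normSq_pos.2 h1)
  rw [Complex.normSq_apply] at h2
  simp
  nlinarith

open Complex Metric Set Filter Topology in
/-- The conformal map of the unit disk onto the disk with the slit `[r, 1)` removed. -/
theorem exists_injOn_mapsTo_ball_ne {r : ℝ} (hr : 0 < r) (hr1 : r < 1) :
    ∃ p : ℂ → ℂ, DifferentiableOn ℂ p (ball 0 1) ∧ InjOn p (ball 0 1) ∧
      MapsTo p (ball 0 1) (ball 0 1) ∧ p 0 = 0 ∧ deriv p 0 = (4 * r / (1 + r) ^ 2 : ℝ) ∧
      ∀ z ∈ ball (0 : ℂ) 1, p z ≠ r := by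
  -- The Cayley transform `u` sends the disk to the right half plane, and `v = 1 - c + c u²` sends
  -- that to the plane slit along `(-∞, 1 - c]`. The root `s` and a second Cayley transform lead
  -- back to the disk. The choice of `c` makes `√(1 - c) = (1 - r)/(1 + r)`, the Cayley image of
  -- `r`, so `p z = r` would force `u z = 0`.
  set c : ℝ := 4 * r / (1 + r) ^ 2 with hc
  have hc0 : 0 < c := by positivity
  have hc1 : c < 1 := by
    rw [hc, div_lt_one (by positivity)]
    nlinarith [sq_pos_of_pos (sub_pos.2 hr1)]
  set u : ℂ → ℂ := fun z => (1 - z) / (1 + z) with hu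
  set v : ℂ → ℂ := fun z => 1 - c + c * u z ^ 2 with hv
  set s : ℂ → ℂ := fun z => exp (log (v z) / 2) with hs
  have h0 : (0 : ℂ) ∈ ball (0 : ℂ) 1 := mem_ball_self one_pos
  have hure : ∀ z ∈ ball (0 : ℂ) 1, 0 < (u z).re := fun z hz => re_one_sub_div_one_add_pos hz
  have h1z : ∀ z ∈ ball (0 : ℂ) 1, 1 + z ≠ 0 := by
    intro z hz h
    have := hure z hz
    simp [hu, h] at this
  have hvs : ∀ z ∈ ball (0 : ℂ) 1, v z ∈ slitPlane := by
    intro z hz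
    by_contra hcon
    rw [Complex.mem_slitPlane_iff, not_or, not_lt, not_not] at hcon
    have hre := hure z hz
    have e1 : (v z).re = 1 - c + c * ((u z).re ^ 2 - (u z).im ^ 2) := by
      simp [hv, pow_two]
    have e2 : (v z).im = c * (2 * (u z).re * (u z).im) := by
      simp [hv, pow_two]
      left
      ring
    rw [e1, e2] at hcon
    have h3 : (u z).im = 0 := by
      have := (mul_eq_zero.1 hcon.2).resolve_left hc0.ne'
      exact (mul_eq_zero.1 this).resolve_left (by positivity)
    rw [h3] at hcon
    have : 0 < c * (u z).re ^ 2 := by positivity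
    nlinarith [hcon.1]
  have hs2 : ∀ z ∈ ball (0 : ℂ) 1, s z ^ 2 = v z := by
    intro z hz
    rw [hs, ← Complex.exp_nat_mul]
    push_cast
    rw [mul_div_cancel₀ _ two_ne_zero, Complex.exp_log (slitPlane_ne_zero (hvs z hz))]
  have hsre : ∀ z ∈ ball (0 : ℂ) 1, 0 < (s z).re := fun z hz => re_exp_half_log_pos (hvs z hz)
  have h1s : ∀ z ∈ ball (0 : ℂ) 1, 1 + s z ≠ 0 := by
    intro z hz h
    have := hsre z hz
    rw [show s z = -1 by linear_combination h] at this
    norm_num at this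
  have hud : ∀ z ∈ ball (0 : ℂ) 1, HasDerivAt u (-2 / (1 + z) ^ 2) z := by
    intro z hz
    refine (((hasDerivAt_id z).const_sub 1).div ((hasDerivAt_id z).const_add 1)
      (h1z z hz)).congr_deriv ?_
    simp
    ring
  have hvd : ∀ z ∈ ball (0 : ℂ) 1, HasDerivAt v (c * (2 * u z * (-2 / (1 + z) ^ 2))) z := by
    intro z hz
    refine ((((hud z hz).pow 2).const_mul (c : ℂ)).const_add (1 - c : ℂ)).congr_deriv ?_
    simp
  have hsd : ∀ z ∈ ball (0 : ℂ) 1,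
      HasDerivAt s (s z * (c * (2 * u z * (-2 / (1 + z) ^ 2)) / v z / 2)) z := fun z hz =>
    (((hvd z hz).clog (hvs z hz)).div_const 2).cexp
  have hpd : ∀ z ∈ ball (0 : ℂ) 1, HasDerivAt (fun z => (1 - s z) / (1 + s z))
      (-2 * (s z * (c * (2 * u z * (-2 / (1 + z) ^ 2)) / v z / 2)) / (1 + s z) ^ 2) z := by
    intro z hz
    refine (((hsd z hz).const_sub 1).div ((hsd z hz).const_add 1) (h1s z hz)).congr_deriv ?_
    congr 1
    ring
  have hu0 : u 0 = 1 := by simp [hu]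
  have hv0 : v 0 = 1 := by simp [hv, hu0]
  have hs0 : s 0 = 1 := by simp [hs, hv0]
  refine ⟨fun z => (1 - s z) / (1 + s z),
    fun z hz => (hpd z hz).differentiableAt.differentiableWithinAt, ?_, ?_, by simp [hs0], ?_, ?_⟩
  · intro a ha b hb hab
    have hsab : s a = s b := by
      have := h1s a ha
      have := h1s b hb
      simp only at hab
      field_simp at hab
      linear_combination -hab / 2
    have hvab : v a = v b := by rw [← hs2 a ha, ← hs2 b hb, hsab]
    have hu2 : (u a - u b) * (u a + u b) = 0 := by
      have : (c : ℂ) * ((u a - u b) * (u a + u b)) = 0 := by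
        simp only [hv] at hvab
        linear_combination hvab
      exact (mul_eq_zero.1 this).resolve_left (by exact_mod_cast hc0.ne')
    have hne : u a + u b ≠ 0 := by
      intro h
      have h3 := congrArg Complex.re h
      have := hure a ha
      have := hure b hb
      simp only [Complex.add_re, Complex.zero_re] at h3
      linarith
    have huab := sub_eq_zero.1 ((mul_eq_zero.1 hu2).resolve_right hne)
    have := h1z a ha
    have := h1z b hb
    simp only [hu] at huab
    field_simp at huab
    linear_combination -huab / 2
  · intro z hz
    have := hsre z hz
    rw [mem_ball_zero_iff, norm_div, div_lt_one (norm_pos_iff.2 (h1s z hz)),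
      ← sq_lt_sq₀ (norm_nonneg _) (norm_nonneg _), ← Complex.normSq_eq_norm_sq,
      ← Complex.normSq_eq_norm_sq, Complex.normSq_apply, Complex.normSq_apply]
    simp
    nlinarith
  · rw [(hpd 0 h0).deriv, hu0, hv0, hs0]
    norm_num
    ring
  · intro z hz h
    have hrc : (1 : ℂ) + r ≠ 0 := by
      have : (1 : ℝ) + r ≠ 0 := by positivity
      exact_mod_cast this
    have hcr : (c : ℂ) * (1 + r) ^ 2 = 4 * r := by
      have : c * (1 + r) ^ 2 = 4 * r := by rw [hc]; field_simp
      exact_mod_cast this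
    have h2 : (1 - r : ℂ) = s z * (1 + r) := by
      rw [div_eq_iff (h1s z hz)] at h
      linear_combination h
    have h3 : (1 - r : ℂ) ^ 2 = v z * (1 + r) ^ 2 := by rw [h2, mul_pow, hs2 z hz]
    have h4 : (c : ℂ) * (1 + r) ^ 2 * u z ^ 2 = 0 := by
      simp only [hv] at h3
      linear_combination -h3 + hcr
    have h5 : u z = 0 := by
      have hc0' : (c : ℂ) ≠ 0 := by exact_mod_cast hc0.ne'
      simpa [hc0', hrc] using h4
    have := hure z hz
    simp [h5] at this

open Complex Metric Set Filter Topology in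
/-- The lower bound of the growth theorem. -/
theorem norm_deriv_mul_le_norm_sub {f : ℂ → ℂ} (hf : DifferentiableOn ℂ f (ball 0 1))
    (hinj : InjOn f (ball 0 1)) {z : ℂ} (hz : z ∈ ball (0 : ℂ) 1) :
    ‖deriv f 0‖ * ‖z‖ ≤ (1 + ‖z‖) ^ 2 * ‖f z - f 0‖ := by
  rcases eq_or_ne z 0 with rfl | hz0
  · simp
  have h0 : (0 : ℂ) ∈ ball (0 : ℂ) 1 := mem_ball_self one_pos
  have hr : 0 < ‖z‖ := norm_pos_iff.2 hz0
  obtain ⟨p, hpd, hpinj, hpm, hp0, hpder, hpne⟩ := exists_injOn_mapsTo_ball_ne hr (by simpa using hz)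
  set r := ‖z‖ with hr_def
  have hrc : (r : ℂ) ≠ 0 := by exact_mod_cast hr.ne'
  set u : ℂ := z / r with hu
  have hun : ‖u‖ = 1 := by
    rw [hu, norm_div, Complex.norm_real, Real.norm_of_nonneg hr.le, ← hr_def, div_self hr.ne']
  have hu0 : u ≠ 0 := norm_pos_iff.1 (by rw [hun]; exact one_pos)
  have hur : u * r = z := by simp [hu, hrc]
  have hum : ∀ w ∈ ball (0 : ℂ) 1, u * w ∈ ball (0 : ℂ) 1 := by
    intro w hw
    simpa [hun] using hw
  have hup : MapsTo (fun w => u * p w) (ball 0 1) (ball 0 1) := fun w hw => hum _ (hpm hw)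
  -- As `p` omits `r`, the composite omits `f (u r) = f z`, so the quarter theorem bounds the
  -- distance to that value.
  have hG := norm_deriv_le_four_mul_norm_sub_of_notMem (f := fun w => f (u * p w)) (w := f z)
    (hf.comp (hpd.const_mul u) hup)
    (hinj.comp (fun a ha b hb hab => hpinj ha hb (mul_left_cancel₀ hu0 hab)) hup)
    (by
      rintro ⟨w, hw, hfw⟩
      have := hinj (hup hw) hz hfw
      rw [← hur] at this
      exact hpne w hw (mul_left_cancel₀ hu0 this))
  have hder : HasDerivAt (fun w => f (u * p w)) (deriv f 0 * (u * (4 * r / (1 + r) ^ 2 : ℝ))) 0 := by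
    have h1 := ((hpd.differentiableAt (isOpen_ball.mem_nhds h0)).hasDerivAt).const_mul u
    rw [hpder] at h1
    have h2 := (hf.differentiableAt (isOpen_ball.mem_nhds h0)).hasDerivAt
    exact HasDerivAt.comp_of_eq 0 h2 h1 (by simp [hp0])
  rw [hder.deriv, norm_mul, norm_mul, hun, Complex.norm_real, Real.norm_of_nonneg (by positivity),
    hp0, mul_zero, one_mul, mul_div_assoc', div_le_iff₀ (by positivity)] at hG
  linarith

open Complex Metric Set Filter Topology in
/-- The Koebe transform of a univalent function. -/
theorem exists_koebe_transform {f : ℂ → ℂ} (hf : DifferentiableOn ℂ f (ball 0 1))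
    (hinj : InjOn f (ball 0 1)) {z : ℂ} (hz : z ∈ ball (0 : ℂ) 1) :
    ∃ G : ℂ → ℂ, DifferentiableOn ℂ G (ball 0 1) ∧ InjOn G (ball 0 1) ∧ G 0 = f z ∧
      G (-z) = f 0 ∧ ‖deriv G 0‖ = ‖deriv f z‖ * (1 - ‖z‖ ^ 2) := by
  have h0 : (0 : ℂ) ∈ ball (0 : ℂ) 1 := mem_ball_self one_pos
  have hz1 : ‖z‖ < 1 := by simpa using hz
  -- The disk automorphism taking `0` to `z` and `-z` to `0`, with `m'(0) = 1 - |z|²`.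
  set m : ℂ → ℂ := fun ζ => (ζ + z) / (1 + (starRingEnd ℂ) z * ζ) with hm
  have hden : ∀ ζ ∈ ball (0 : ℂ) 1, 1 + (starRingEnd ℂ) z * ζ ≠ 0 := by
    intro ζ hζ h
    have h1 : ‖(starRingEnd ℂ) z * ζ‖ = 1 := by
      rw [show (starRingEnd ℂ) z * ζ = -1 by linear_combination h]; simp
    rw [norm_mul, RCLike.norm_conj] at h1
    have hζ1 : ‖ζ‖ < 1 := by simpa using hζ
    have := mul_lt_one_of_nonneg_of_lt_one_left (norm_nonneg z) hz1 hζ1.le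
    linarith
  have hmd : ∀ ζ ∈ ball (0 : ℂ) 1, HasDerivAt m
      ((1 * (1 + (starRingEnd ℂ) z * ζ) - (ζ + z) * ((starRingEnd ℂ) z * 1)) /
        (1 + (starRingEnd ℂ) z * ζ) ^ 2) ζ := fun ζ hζ =>
    ((hasDerivAt_id ζ).add_const z).div
      (((hasDerivAt_id ζ).const_mul ((starRingEnd ℂ) z)).const_add 1) (hden ζ hζ)
  have hconj : z * (starRingEnd ℂ) z = (‖z‖ : ℂ) ^ 2 := Complex.mul_conj' z
  have hfac : (1 : ℂ) - z * (starRingEnd ℂ) z ≠ 0 := by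
    rw [hconj]
    have : (1 : ℝ) - ‖z‖ ^ 2 ≠ 0 := by nlinarith [norm_nonneg z]
    exact_mod_cast this
  have hmaps : MapsTo m (ball 0 1) (ball 0 1) := by
    intro ζ hζ
    have h1 : normSq ζ < 1 := by
      rw [Complex.normSq_eq_norm_sq]
      exact pow_lt_one₀ (norm_nonneg ζ) (by simpa using hζ) two_ne_zero
    have h2 : normSq z < 1 := by
      rw [Complex.normSq_eq_norm_sq]
      exact pow_lt_one₀ (norm_nonneg z) hz1 two_ne_zero
    rw [mem_ball_zero_iff, norm_div, div_lt_one (norm_pos_iff.2 (hden ζ hζ)),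
      ← sq_lt_sq₀ (norm_nonneg _) (norm_nonneg _), ← Complex.normSq_eq_norm_sq,
      ← Complex.normSq_eq_norm_sq]
    have h3 := mul_pos (sub_pos.2 h1) (sub_pos.2 h2)
    simp only [Complex.normSq_apply] at *
    simp
    nlinarith
  have hminj : InjOn m (ball 0 1) := by
    intro a ha b hb hab
    have h1 := hden a ha
    have h2 := hden b hb
    simp only [hm] at hab
    rw [div_eq_div_iff h1 h2] at hab
    have : (1 - z * (starRingEnd ℂ) z) * (a - b) = 0 := by linear_combination hab
    exact sub_eq_zero.1 ((mul_eq_zero.1 this).resolve_left hfac)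
  have hm0 : m 0 = z := by simp [hm]
  refine ⟨f ∘ m, hf.comp (fun ζ hζ => (hmd ζ hζ).differentiableAt.differentiableWithinAt) hmaps,
    hinj.comp hminj hmaps, by simp [hm0], by simp [hm], ?_⟩
  have h2 := (hf.differentiableAt (isOpen_ball.mem_nhds hz)).hasDerivAt
  rw [(HasDerivAt.comp_of_eq 0 h2 (hmd 0 h0) hm0.symm).deriv, norm_mul]
  congr 1
  have : (1 : ℂ) * (1 + (starRingEnd ℂ) z * 0) - (0 + z) * ((starRingEnd ℂ) z * 1) =
      ((1 - ‖z‖ ^ 2 : ℝ) : ℂ) := by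
    push_cast
    rw [← hconj]
    ring
  rw [this, norm_div, Complex.norm_real, Real.norm_of_nonneg (by nlinarith [norm_nonneg z])]
  simp

open Complex Metric Set Filter Topology in
-- The lower growth bound for the Koebe transform at `-z`, with one factor `1 + |z|` cancelled.
theorem norm_mul_norm_deriv_le {f : ℂ → ℂ} (hf : DifferentiableOn ℂ f (ball 0 1))
    (hinj : InjOn f (ball 0 1)) {z : ℂ} (hz : z ∈ ball (0 : ℂ) 1) :
    (1 - ‖z‖) * (‖z‖ * ‖deriv f z‖) ≤ (1 + ‖z‖) * ‖f z - f 0‖ := by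
  obtain ⟨G, hGd, hGi, hG0, hGz, hGder⟩ := exists_koebe_transform hf hinj hz
  have := norm_deriv_mul_le_norm_sub hGd hGi (z := -z) (by simpa using hz)
  rw [hGder, hG0, hGz, norm_neg, norm_sub_rev] at this
  refine le_of_mul_le_mul_left ?_ (by positivity : 0 < 1 + ‖z‖)
  linarith

open Complex Metric Set Filter Topology in
/-- The upper bound of the growth theorem. -/
theorem norm_sub_mul_le_norm_deriv {f : ℂ → ℂ} (hf : DifferentiableOn ℂ f (ball 0 1))
    (hinj : InjOn f (ball 0 1)) {z : ℂ} (hz : z ∈ ball (0 : ℂ) 1) :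
    (1 - ‖z‖) ^ 2 * ‖f z - f 0‖ ≤ ‖deriv f 0‖ * ‖z‖ := by
  rcases eq_or_ne z 0 with rfl | hz0
  · simp
  have h0 : (0 : ℂ) ∈ ball (0 : ℂ) 1 := mem_ball_self one_pos
  have hr : 0 < ‖z‖ := norm_pos_iff.2 hz0
  have hr1 : ‖z‖ < 1 := by simpa using hz
  set r := ‖z‖ with hr_def
  have hrc : (r : ℂ) ≠ 0 := by exact_mod_cast hr.ne'
  set u : ℂ := z / r with hu
  have hun : ‖u‖ = 1 := by
    rw [hu, norm_div, Complex.norm_real, Real.norm_of_nonneg hr.le, ← hr_def, div_self hr.ne']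
  have hur : (r : ℂ) * u = z := by rw [hu]; field_simp
  set h := dslope f 0 with hh
  have hhd : DifferentiableOn ℂ h (ball 0 1) :=
    (differentiableOn_dslope (isOpen_ball.mem_nhds h0)).2 hf
  have hfh : ∀ w, f w - f 0 = w * h w := by
    intro w
    have := sub_smul_dslope f 0 w
    simpa using this.symm
  have hhat : ∀ w ∈ ball (0 : ℂ) 1, HasDerivAt h (deriv h w) w := fun w hw =>
    (hhd.differentiableAt (isOpen_ball.mem_nhds hw)).hasDerivAt
  have hfder : ∀ w ∈ ball (0 : ℂ) 1, deriv f w = h w + w * deriv h w := by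
    intro w hw
    have h1 : f = fun w => w * h w + f 0 := by
      ext w; rw [← hfh]; ring
    have h2 := (((hasDerivAt_id w).mul (hhat w hw)).add_const (f 0)).deriv
    conv_lhs => rw [h1]
    refine h2.trans ?_
    simp
  have htb : ∀ t ∈ Icc (0 : ℝ) r, (t : ℂ) * u ∈ ball (0 : ℂ) 1 := by
    intro t ht
    rw [mem_ball_zero_iff, norm_mul, hun, Complex.norm_real, Real.norm_of_nonneg ht.1]
    linarith [ht.2]
  -- For `h = (f - f 0)/z`, the bound on `|z f'|` says that the logarithmic derivative of `|h|`
  -- along the radius is at most `2/(1 - t)`. Monotonicity of `|h|²(1 - t)⁴` expresses this without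
  -- dividing by `h`.
  set ψ : ℝ → ℝ := fun t => ‖h (t * u)‖ ^ 2 * (1 - t) ^ 4 with hψ
  have hψd : ∀ t ∈ Icc (0 : ℝ) r, HasDerivAt ψ
      (2 * inner ℝ (h (t * u)) (deriv h (t * u) * u) * (1 - t) ^ 4 +
        ‖h (t * u)‖ ^ 2 * (4 * (1 - t) ^ 3 * (-1))) t := by
    intro t ht
    have h1 : HasDerivAt (fun t : ℝ => (t : ℂ) * u) u t := by
      simpa using (Complex.ofRealCLM.hasDerivAt (x := t)).mul_const u
    have h2 : HasDerivAt (fun t : ℝ => h (t * u)) (deriv h (t * u) * u) t :=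
      HasDerivAt.comp (𝕜' := ℂ) t (hhat _ (htb t ht)) h1
    have h3 : HasDerivAt (fun t : ℝ => (1 - t) ^ 4) (4 * (1 - t) ^ 3 * (-1)) t := by
      exact (((hasDerivAt_id t).const_sub 1).pow 4).congr_deriv (by simp)
    exact h2.norm_sq.mul h3
  have hanti : AntitoneOn ψ (Icc 0 r) := by
    refine antitoneOn_of_deriv_nonpos (convex_Icc 0 r)
      (fun t ht => (hψd t ht).continuousAt.continuousWithinAt)
      (fun t ht => (hψd t (interior_subset ht)).differentiableAt.differentiableWithinAt) ?_
    intro t ht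
    rw [interior_Icc] at ht
    have htI : t ∈ Icc (0 : ℝ) r := Ioo_subset_Icc_self ht
    rw [(hψd t htI).deriv]
    set w : ℂ := (t : ℂ) * u with hw
    have hwn : ‖w‖ = t := by
      rw [hw, norm_mul, hun, Complex.norm_real, Real.norm_of_nonneg ht.1.le, mul_one]
    have hA := norm_mul_norm_deriv_le hf hinj (htb t htI)
    rw [← hw, hwn, hfder w (htb t htI), hfh w, norm_mul, hwn] at hA
    have hA' : (1 - t) * ‖h w + w * deriv h w‖ ≤ (1 + t) * ‖h w‖ := by
      refine le_of_mul_le_mul_left ?_ ht.1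
      linarith
    have hin : inner ℝ (h w) (h w + w * deriv h w) =
        ‖h w‖ ^ 2 + t * inner ℝ (h w) (deriv h w * u) := by
      have : w * deriv h w = t • (deriv h w * u) := by
        rw [hw, Complex.real_smul]; ring
      rw [inner_add_right, real_inner_self_eq_norm_sq, this, real_inner_smul_right]
    have hcs := real_inner_le_norm (h w) (h w + w * deriv h w)
    rw [hin] at hcs
    have ht1 : 0 < 1 - t := by linarith [ht.2]
    have h5 : (1 - t) * inner ℝ (h w) (deriv h w * u) ≤ 2 * ‖h w‖ ^ 2 := by
      have h6 := mul_le_mul_of_nonneg_left hcs ht1.le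
      have h7 := mul_le_mul_of_nonneg_left hA' (norm_nonneg (h w))
      refine le_of_mul_le_mul_left ?_ ht.1
      linarith
    have h8 := mul_le_mul_of_nonneg_left h5 (by positivity : 0 ≤ 2 * (1 - t) ^ 3)
    linarith
  have hfin := hanti (left_mem_Icc.2 hr.le) (right_mem_Icc.2 hr.le) hr.le
  simp only [hψ, hur, Complex.ofReal_zero, zero_mul, sub_zero, one_pow, mul_one] at hfin
  have h9 : ‖h z‖ * (1 - r) ^ 2 ≤ ‖h 0‖ := by
    refine le_of_sq_le_sq ?_ (norm_nonneg _)
    linarith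
  have h10 : h 0 = deriv f 0 := dslope_same f 0
  rw [hfh, norm_mul, ← h10, ← hr_def]
  have := mul_le_mul_of_nonneg_right h9 hr.le
  linarith

open Complex Metric Set Filter Topology in
-- The upper growth bound for the Koebe transform at `-z`, with one factor `1 - |z|` cancelled.
theorem mul_norm_sub_le_norm_mul_norm_deriv {f : ℂ → ℂ} (hf : DifferentiableOn ℂ f (ball 0 1))
    (hinj : InjOn f (ball 0 1)) {z : ℂ} (hz : z ∈ ball (0 : ℂ) 1) :
    (1 - ‖z‖) * ‖f z - f 0‖ ≤ (1 + ‖z‖) * (‖z‖ * ‖deriv f z‖) := by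
  obtain ⟨G, hGd, hGi, hG0, hGz, hGder⟩ := exists_koebe_transform hf hinj hz
  have hz1 : ‖z‖ < 1 := by simpa using hz
  have := norm_sub_mul_le_norm_deriv hGd hGi (z := -z) (by simpa using hz)
  rw [hGder, hG0, hGz, norm_neg, norm_sub_rev] at this
  refine le_of_mul_le_mul_left ?_ (sub_pos.2 hz1)
  linarith

/-! ### Littlewood's integral means. -/

open Complex Metric Set MeasureTheory Filter Topology in
/-- A Bessel inequality for the area of the image of a disk under an injective function. -/
theorem sum_sq_taylorCoeff_le_of_injOn {h : ℂ → ℂ} (hh : DifferentiableOn ℂ h (ball 0 1))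
    (hinj : InjOn h (ball 0 1)) {t M : ℝ} (ht : 0 < t) (ht1 : t < 1) (hM0 : 0 ≤ M)
    (hM : ∀ z, ‖z‖ < t → ‖h z‖ ≤ M) (N : ℕ) :
    ∑ n ∈ Finset.range N, (n + 1) *
      ‖iteratedDeriv (n + 1) h 0 / ((n + 1).factorial : ℂ)‖ ^ 2 * t ^ (2 * n + 2) ≤ M ^ 2 := by
  set a : ℕ → ℝ := fun n => ‖iteratedDeriv (n + 1) h 0 / ((n + 1).factorial : ℂ)‖ ^ 2 with ha
  set A : Set ℂ := {z : ℂ | 0 < ‖z‖ ∧ ‖z‖ < t} with hA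
  have hAo : IsOpen A := (isOpen_lt continuous_const continuous_norm).inter
    (isOpen_lt continuous_norm continuous_const)
  have hAball : A ⊆ ball 0 1 := fun z hz => by simpa using hz.2.trans ht1
  have hder := hh.deriv isOpen_ball
  have hfd : ∀ z ∈ A, HasFDerivWithinAt h (deriv h z • (1 : ℂ →L[ℝ] ℂ)) A z := fun z hz =>
    ((hh.differentiableAt (isOpen_ball.mem_nhds (hAball hz))).hasDerivAt.complexToReal_fderiv
      ).hasFDerivWithinAt
  have hvol := lintegral_abs_det_fderiv_eq_addHaar_image volume hAo.measurableSet hfd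
    (hinj.mono hAball)
  have hdet : ∀ z, (deriv h z • (1 : ℂ →L[ℝ] ℂ)).det = ‖deriv h z‖ ^ 2 := by
    intro z
    have := det_mul_add_mul_conj (deriv h z) 0
    rw [norm_zero, zero_pow two_ne_zero, sub_zero] at this
    rw [← this]
    congr 1
    ext <;> simp
  simp only [hdet, abs_pow, abs_norm] at hvol
  have hle : volume (h '' A) ≤ ENNReal.ofReal (Real.pi * M ^ 2) := by
    refine (measure_mono (t := closedBall 0 M) ?_).trans (le_of_eq ?_)
    · rintro _ ⟨z, hz, rfl⟩
      simpa using hM z hz.2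
    · rw [Complex.volume_closedBall, mul_comm, ENNReal.ofReal_mul Real.pi_pos.le,
        ENNReal.ofReal_pow hM0, ← NNReal.coe_real_pi, ENNReal.ofReal_coe_nnreal]
  -- A truncation of Parseval's sum for `h'`, whose `n`-th coefficient is `n + 1` times the
  -- coefficient of `h` of index `n + 1`. Finitely many terms keep the radial integration
  -- elementary.
  set m : ℝ → ℝ := fun r => ∑ n ∈ Finset.range N, (n + 1 : ℝ) ^ 2 * a n * r ^ (2 * n) with hm
  have hcontm : Continuous fun r : ℝ => 2 * Real.pi * (r * m r) := by fun_prop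
  have hm_le : ∀ r ∈ Ioo (0 : ℝ) t, m r ≤ Real.circleAverage (fun z => ‖deriv h z‖ ^ 2) 0 r := by
    intro r hr
    have hr0 := hr.1
    have hp := hasSum_sq_taylorCoeff_circleAverage hder hr.1 (hr.2.trans ht1)
    refine le_trans (le_of_eq ?_) (sum_le_hasSum (Finset.range N) (fun i _ => by positivity) hp)
    refine Finset.sum_congr rfl fun n _ => ?_
    congr 1
    have hn : (n.factorial : ℂ) ≠ 0 := by exact_mod_cast n.factorial_ne_zero
    have hn1 : (n : ℂ) + 1 ≠ 0 := by exact_mod_cast n.succ_ne_zero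
    have : iteratedDeriv n (deriv h) 0 / (n.factorial : ℂ) =
        ((n + 1 : ℝ) : ℂ) * (iteratedDeriv (n + 1) h 0 / ((n + 1).factorial : ℂ)) := by
      rw [← iteratedDeriv_succ', Nat.factorial_succ]
      push_cast
      field_simp
    rw [this, norm_mul, Complex.norm_real, Real.norm_of_nonneg (by positivity), mul_pow]
  have hlow := ofReal_integral_le_lintegral_annulus (F := fun z => ‖deriv h z‖ ^ 2) le_rfl ht.le
    ((hder.continuousOn.mono hAball).norm.pow 2) (fun z => by positivity) hm_le
    (hcontm.intervalIntegrable _ _) (fun r _ => by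
      have : Even (2 : ℕ) := even_two
      simp only [hm, pow_mul]
      positivity)
  have hint : ∫ r in (0 : ℝ)..t, 2 * Real.pi * (r * m r) =
      Real.pi * ∑ n ∈ Finset.range N, (n + 1) * a n * t ^ (2 * n + 2) := by
    rw [intervalIntegral.integral_eq_sub_of_hasDerivAt
      (f := fun r => Real.pi * ∑ n ∈ Finset.range N, (n + 1) * a n * r ^ (2 * n + 2)) ?_
      (hcontm.intervalIntegrable _ _)]
    · simp
    · intro r _
      have h1 : HasDerivAt (fun r : ℝ => ∑ n ∈ Finset.range N, (n + 1) * a n * r ^ (2 * n + 2))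
          (∑ n ∈ Finset.range N, (n + 1) * a n * (((2 * n + 2 : ℕ) : ℝ) * r ^ (2 * n + 1))) r :=
        HasDerivAt.fun_sum fun n _ => (hasDerivAt_pow (2 * n + 2) r).const_mul _
      refine (h1.const_mul Real.pi).congr_deriv ?_
      simp only [hm, Finset.mul_sum]
      refine Finset.sum_congr rfl fun n _ => ?_
      push_cast
      ring
  have hfin := (hlow.trans_eq hvol).trans hle
  rw [hint, ENNReal.ofReal_le_ofReal_iff (by positivity)] at hfin
  exact le_of_mul_le_mul_left hfin Real.pi_pos

open Complex Metric Set MeasureTheory Filter Topology in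
-- Squaring wraps the circle twice around its image at constant speed.
theorem circleAverage_comp_sq {G : ℂ → ℝ} {t : ℝ}
    (hG : Continuous fun θ => G (circleMap 0 (t ^ 2) θ)) :
    Real.circleAverage (fun z => G (z ^ 2)) 0 t = Real.circleAverage G 0 (t ^ 2) := by
  have h1 : ∀ θ, circleMap 0 t θ ^ 2 = circleMap 0 (t ^ 2) (2 * θ) := by
    intro θ
    simp only [circleMap_zero, mul_pow, ← Complex.exp_nat_mul]
    push_cast
    ring_nf
  have hper : (fun θ => G (circleMap 0 (t ^ 2) θ)).Periodic (2 * Real.pi) := fun θ => by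
    simp only [periodic_circleMap 0 (t ^ 2) θ]
  rw [Real.circleAverage_def, Real.circleAverage_def]
  congr 1
  simp only [h1]
  rw [intervalIntegral.integral_comp_mul_left (fun θ => G (circleMap 0 (t ^ 2) θ)) two_ne_zero,
    mul_zero, two_mul (2 * Real.pi),
    hper.intervalIntegral_add_eq_add _ _ fun _ _ => hG.intervalIntegrable _ _, zero_add,
    smul_eq_mul]
  ring

open Complex Metric Set MeasureTheory Filter Topology in
-- The image of `|z| < s` lies in a disk of radius `s/(1 - s²)`, so `∑ n|a_n|² s^{2n} ≤ s²/(1 -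
-- s²)²`. Multiplied by `2/s`, this compares the derivatives of `∑ |a_n|² s^{2n}` and `(1 - s²)⁻¹`;
-- integration over `[0, t]` finishes.
theorem circleAverage_sq_le_of_injOn {h : ℂ → ℂ} (hh : DifferentiableOn ℂ h (ball 0 1))
    (hinj : InjOn h (ball 0 1)) (h0 : h 0 = 0)
    (hM : ∀ z ∈ ball (0 : ℂ) 1, ‖h z‖ ≤ ‖z‖ / (1 - ‖z‖ ^ 2)) {t : ℝ} (ht : 0 < t) (ht1 : t < 1) :
    Real.circleAverage (fun z => ‖h z‖ ^ 2) 0 t ≤ t ^ 2 / (1 - t ^ 2) := by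
  set a : ℕ → ℝ := fun n => ‖iteratedDeriv n h 0 / (n.factorial : ℂ)‖ ^ 2 with ha
  have ha0 : a 0 = 0 := by simp [ha, h0]
  have hpos : ∀ s ∈ Icc 0 t, 0 < 1 - s ^ 2 := by
    intro s hs
    have := pow_lt_one₀ hs.1 (hs.2.trans_lt ht1) two_ne_zero
    linarith
  have harea : ∀ (N : ℕ), ∀ s ∈ Ioo 0 t, ∑ n ∈ Finset.range N,
      (n + 1) * a (n + 1) * s ^ (2 * n + 2) ≤ (s / (1 - s ^ 2)) ^ 2 := by
    intro N s hs
    have hs2 := hpos s (Ioo_subset_Icc_self hs)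
    have hs1 : s < 1 := hs.2.trans ht1
    refine sum_sq_taylorCoeff_le_of_injOn hh hinj hs.1 hs1 (div_nonneg hs.1.le hs2.le) ?_ N
    intro z hz
    refine (hM z (by simpa using hz.trans hs1)).trans ?_
    exact div_le_div₀ hs.1.le hz.le hs2 (by nlinarith [norm_nonneg z])
  have hpart : ∀ N : ℕ, ∑ n ∈ Finset.range N, a (n + 1) * t ^ (2 * n + 2) ≤ t ^ 2 / (1 - t ^ 2) := by
    intro N
    set D : ℝ → ℝ := fun s =>
      (1 - s ^ 2)⁻¹ - ∑ n ∈ Finset.range N, a (n + 1) * s ^ (2 * n + 2) with hD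
    have hDd : ∀ s ∈ Icc 0 t, HasDerivAt D (-(-(2 * s)) / (1 - s ^ 2) ^ 2 -
        ∑ n ∈ Finset.range N, a (n + 1) * (((2 * n + 2 : ℕ) : ℝ) * s ^ (2 * n + 1))) s := by
      intro s hs
      have h1 : HasDerivAt (fun s : ℝ => 1 - s ^ 2) (-(2 * s)) s := by
        simpa using (hasDerivAt_pow 2 s).const_sub 1
      exact (h1.inv (hpos s hs).ne').sub
        (HasDerivAt.fun_sum fun n _ => (hasDerivAt_pow (2 * n + 2) s).const_mul _)
    have hmono : MonotoneOn D (Icc 0 t) := by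
      refine monotoneOn_of_deriv_nonneg (convex_Icc 0 t)
        (fun s hs => (hDd s hs).continuousAt.continuousWithinAt)
        (fun s hs => (hDd s (interior_subset hs)).differentiableAt.differentiableWithinAt) ?_
      intro s hs
      rw [interior_Icc] at hs
      rw [(hDd s (Ioo_subset_Icc_self hs)).deriv]
      have h2 := harea N s hs
      have h3 : ∑ n ∈ Finset.range N, a (n + 1) * (((2 * n + 2 : ℕ) : ℝ) * s ^ (2 * n + 1)) =
          2 / s * ∑ n ∈ Finset.range N, (n + 1) * a (n + 1) * s ^ (2 * n + 2) := by
        rw [Finset.mul_sum]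
        refine Finset.sum_congr rfl fun n _ => ?_
        have := hs.1.ne'
        push_cast
        field_simp
        ring
      have h4 := mul_le_mul_of_nonneg_left h2 (div_nonneg zero_le_two hs.1.le)
      rw [h3, sub_nonneg]
      refine h4.trans (le_of_eq ?_)
      have := hs.1.ne'
      field_simp
    have h5 := hmono (left_mem_Icc.2 ht.le) (right_mem_Icc.2 ht.le) ht.le
    have h6 : t ^ 2 / (1 - t ^ 2) = (1 - t ^ 2)⁻¹ - 1 := by
      have := (hpos t (right_mem_Icc.2 ht.le)).ne'
      field_simp
      ring
    simp [hD] at h5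
    rw [h6]
    linarith
  have hsum := hasSum_sq_taylorCoeff_circleAverage hh ht ht1
  refine le_of_tendsto ((tendsto_add_atTop_iff_nat 1).2 hsum.tendsto_sum_nat)
    (Eventually.of_forall fun N => ?_)
  rw [Finset.sum_range_succ']
  have : ‖iteratedDeriv 0 h 0 / (Nat.factorial 0 : ℂ)‖ ^ 2 = 0 := ha0
  rw [this, zero_mul, add_zero]
  exact hpart N

open Complex Metric Set MeasureTheory Filter Topology in
/-- Littlewood's bound for the integral means of a normalized univalent function. -/
theorem circleAverage_norm_le_of_injOn {f : ℂ → ℂ} (hf : DifferentiableOn ℂ f (ball 0 1))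
    (hinj : InjOn f (ball 0 1)) (hf0 : f 0 = 0) (hf1 : deriv f 0 = 1) {r : ℝ} (hr : 0 < r)
    (hr1 : r < 1) : Real.circleAverage (fun z => ‖f z‖) 0 r ≤ r / (1 - r) := by
  have h0 : (0 : ℂ) ∈ ball (0 : ℂ) 1 := mem_ball_self one_pos
  set F := dslope f 0 with hF
  have hFd : DifferentiableOn ℂ F (ball 0 1) :=
    (differentiableOn_dslope (isOpen_ball.mem_nhds h0)).2 hf
  have hfF : ∀ w, w * F w = f w := by
    intro w
    have := sub_smul_dslope f 0 w
    simpa [hf0] using this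
  have hF1 : F 0 = 1 := by rw [hF, dslope_same, hf1]
  have hFinj : InjOn (fun z => z * F z) (ball 0 1) := by simpa only [hfF] using hinj
  have hF0 := ne_zero_of_injOn_mul hF1 hFinj
  obtain ⟨k, hkd, -, hk⟩ := exists_differentiableOn_sq_eq hFd hF0 hF1
  have hk0 : ∀ z ∈ ball (0 : ℂ) 1, k z ≠ 0 := by
    intro z hz h
    exact hF0 z hz (by rw [← hk z hz, h]; simp)
  set h : ℂ → ℂ := fun z => z * k (z ^ 2) with hh
  have hhd : DifferentiableOn ℂ h (ball 0 1) := differentiableOn_id.mul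
    (hkd.comp (by fun_prop) fun z hz => sq_mem_ball_zero_one hz)
  have hsq : ∀ z ∈ ball (0 : ℂ) 1, ‖h z‖ ^ 2 = ‖f (z ^ 2)‖ := by
    intro z hz
    rw [← norm_pow, hh]
    simp only
    rw [mul_pow, hk _ (sq_mem_ball_zero_one hz), hfF]
  have hbound : ∀ z ∈ ball (0 : ℂ) 1, ‖h z‖ ≤ ‖z‖ / (1 - ‖z‖ ^ 2) := by
    intro z hz
    have h1 := norm_sub_mul_le_norm_deriv hf hinj (sq_mem_ball_zero_one hz)
    rw [hf0, sub_zero, hf1, norm_one, one_mul, ← hsq z hz, norm_pow, ← mul_pow] at h1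
    have h2 : 0 < 1 - ‖z‖ ^ 2 := by
      have := pow_lt_one₀ (norm_nonneg z) (by simpa using hz) two_ne_zero
      linarith
    rw [le_div_iff₀ h2, mul_comm]
    exact le_of_sq_le_sq h1 (norm_nonneg z)
  -- Since `|h z|² = |f (z²)|`, the mean of `|f|` at radius `r` is that of `|h|²` at radius `√r`.
  set t := Real.sqrt r with ht
  have htr : t ^ 2 = r := Real.sq_sqrt hr.le
  have ht0 : 0 < t := Real.sqrt_pos.2 hr
  have ht1 : t < 1 := (Real.sqrt_lt' one_pos).2 (by simpa using hr1)
  have hmain := circleAverage_sq_le_of_injOn hhd (injOn_mul_comp_sq hFinj hk hk0) (by simp [hh])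
    hbound ht0 ht1
  rw [htr] at hmain
  have hcont : Continuous fun θ => ‖f (circleMap 0 (t ^ 2) θ)‖ := by
    refine (hf.continuousOn.comp_continuous (continuous_circleMap 0 _) fun θ => ?_).norm
    rw [htr, mem_ball_zero_iff, norm_circleMap_zero, abs_of_pos hr]
    exact hr1
  have hav := circleAverage_comp_sq (G := fun z => ‖f z‖) hcont
  rw [htr] at hav
  rw [← hav]
  refine le_trans (le_of_eq ?_) hmain
  refine Real.circleAverage_congr_sphere fun z hz => (hsq z ?_).symm
  rw [abs_of_pos ht0, mem_sphere_zero_iff_norm] at hz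
  rw [mem_ball_zero_iff, hz]
  exact ht1

/-! ### Slices as copies of the complex plane. -/

namespace SliceRegular

theorem mul_self_of_mem_imagUnits {I : ℍ} (hI : I ∈ imagUnits) : I * I = -1 := by
  have h1 : star I = -I := Quaternion.star_eq_neg.2 hI.1
  have h2 := Quaternion.self_mul_star (a := I)
  rw [h1, Quaternion.normSq_eq_norm_mul_self, hI.2, mul_neg, mul_one, Quaternion.coe_one] at h2
  rw [← h2, neg_neg]

/-- The embedding `x + i y ↦ x + I y` of `ℂ` onto the slice `ℂ_I`. -/
noncomputable def sliceEmb {I : ℍ} (hI : I ∈ imagUnits) : ℂ →ₐ[ℝ] ℍ :=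
  Complex.liftAux I (mul_self_of_mem_imagUnits hI)

theorem sliceEmb_apply {I : ℍ} (hI : I ∈ imagUnits) (z : ℂ) :
    sliceEmb hI z = (z.re : ℍ) + I * (z.im : ℍ) := by
  rw [sliceEmb, Complex.liftAux_apply, Quaternion.mul_coe_eq_smul]
  rfl

theorem sliceEmb_ofReal {I : ℍ} (hI : I ∈ imagUnits) (x : ℝ) : sliceEmb hI x = (x : ℍ) := by
  simp

theorem sliceEmb_I {I : ℍ} (hI : I ∈ imagUnits) : sliceEmb hI Complex.I = I := by
  simp [sliceEmb_apply]

theorem sliceEmb_conj {I : ℍ} (hI : I ∈ imagUnits) (z : ℂ) :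
    sliceEmb hI ((starRingEnd ℂ) z) = star (sliceEmb hI z) := by
  have h1 : star I = -I := Quaternion.star_eq_neg.2 hI.1
  rw [sliceEmb_apply, sliceEmb_apply, star_add, star_mul, Quaternion.star_coe, Quaternion.star_coe, h1]
  simp [Quaternion.mul_coe_eq_smul, Quaternion.coe_mul_eq_smul]

theorem norm_sliceEmb {I : ℍ} (hI : I ∈ imagUnits) (z : ℂ) : ‖sliceEmb hI z‖ = ‖z‖ := by
  have h : ((‖sliceEmb hI z‖ * ‖sliceEmb hI z‖ : ℝ) : ℍ) = ((‖z‖ * ‖z‖ : ℝ) : ℍ) := by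
    rw [← Quaternion.normSq_eq_norm_mul_self, ← Quaternion.self_mul_star, ← sliceEmb_conj, ← map_mul,
      Complex.mul_conj, Complex.normSq_eq_norm_sq, sliceEmb_ofReal, pow_two]
  exact (mul_self_inj (norm_nonneg _) (norm_nonneg _)).1 (Quaternion.coe_injective h)

theorem mem_slicePlane_iff {I : ℍ} (hI : I ∈ imagUnits) {q : ℍ} :
    q ∈ slicePlane I ↔ ∃ z, sliceEmb hI z = q := by
  constructor
  · rintro ⟨x, y, rfl⟩
    exact ⟨⟨x, y⟩, sliceEmb_apply hI _⟩
  · rintro ⟨z, rfl⟩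
    exact ⟨z.re, z.im, sliceEmb_apply hI z⟩

theorem imagUnit_mem_imagUnits (q : ℍ) : imagUnit q ∈ imagUnits := by
  unfold imagUnit
  split_ifs with h
  · refine ⟨by simp, ?_⟩
    have h2 : ‖((Complex.I : ℂ) : ℍ)‖ * ‖((Complex.I : ℂ) : ℍ)‖ = 1 := by
      rw [← Quaternion.normSq_eq_norm_mul_self, Quaternion.normSq_def']
      simp
    nlinarith [norm_nonneg ((Complex.I : ℂ) : ℍ)]
  · refine ⟨by simp, ?_⟩
    rw [norm_smul, norm_inv, norm_norm, inv_mul_cancel₀ (norm_ne_zero_iff.2 h)]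

/-- At a real `q` the default unit is harmless, because it is multiplied by `‖q.im‖ = 0`. -/
theorem sliceEmb_imagUnit (q : ℍ) :
    sliceEmb (imagUnit_mem_imagUnits q) ⟨q.re, ‖q.im‖⟩ = q := by
  rw [sliceEmb_apply]
  unfold imagUnit
  split_ifs with h
  · rw [h, norm_zero]
    conv_rhs => rw [← Quaternion.re_add_im q, h]
    simp
  · rw [Quaternion.mul_coe_eq_smul, smul_smul, mul_inv_cancel₀ (norm_ne_zero_iff.2 h), one_smul,
      Quaternion.re_add_im]

theorem mem_slicePlane_imagUnit (q : ℍ) : q ∈ slicePlane (imagUnit q) :=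
  (mem_slicePlane_iff (imagUnit_mem_imagUnits q)).2 ⟨_, sliceEmb_imagUnit q⟩

theorem exists_sliceEmb_eq (q : ℍ) :
    ∃ z : ℂ, sliceEmb (imagUnit_mem_imagUnits q) z = q := ⟨_, sliceEmb_imagUnit q⟩

/-- The real linear projection of `ℍ` onto `ℂ` which is left inverse to `x + i y ↦ x + I y`. -/
noncomputable def sliceProj (I : ℍ) : ℍ →L[ℝ] ℂ :=
  LinearMap.toContinuousLinearMap
    { toFun := fun q => ⟨q.re, -(I * q).re⟩
      map_add' := fun p q => by
        apply Complex.ext <;> simp [mul_add]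
        ring
      map_smul' := fun c q => by
        apply Complex.ext <;> simp
        ring }

theorem sliceProj_apply (I q : ℍ) : sliceProj I q = ⟨q.re, -(I * q).re⟩ := rfl

/-- Complex linearity of the projection for left multiplication by `I`, which makes slice
restrictions holomorphic. -/
theorem sliceProj_mul {I : ℍ} (hI : I ∈ imagUnits) (q : ℍ) :
    sliceProj I (I * q) = Complex.I * sliceProj I q := by
  rw [sliceProj_apply, sliceProj_apply, ← mul_assoc, mul_self_of_mem_imagUnits hI]
  apply Complex.ext <;> simp

theorem sliceProj_sliceEmb {I : ℍ} (hI : I ∈ imagUnits) (z : ℂ) :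
    sliceProj I (sliceEmb hI z) = z := by
  have h := mul_self_of_mem_imagUnits hI
  have h0 := hI.1
  rw [sliceProj_apply, sliceEmb_apply, mul_add, ← mul_assoc, h, Quaternion.mul_coe_eq_smul,
    Quaternion.mul_coe_eq_smul]
  apply Complex.ext <;> simp [h0]

theorem sliceEmb_injective {I : ℍ} (hI : I ∈ imagUnits) : Function.Injective (sliceEmb hI) :=
  Function.LeftInverse.injective (sliceProj_sliceEmb hI)

/-- `sliceEmb` as a continuous linear map. -/
noncomputable def sliceEmbL {I : ℍ} (hI : I ∈ imagUnits) : ℂ →L[ℝ] ℍ :=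
  LinearMap.toContinuousLinearMap (sliceEmb hI).toLinearMap

theorem sliceEmbL_apply {I : ℍ} (hI : I ∈ imagUnits) (z : ℂ) : sliceEmbL hI z = sliceEmb hI z := rfl

theorem sliceEmb_mem_ball_iff {I : ℍ} (hI : I ∈ imagUnits) {r : ℝ} {z : ℂ} :
    sliceEmb hI z ∈ Metric.ball (0 : ℍ) r ↔ z ∈ Metric.ball (0 : ℂ) r := by
  rw [mem_ball_zero_iff, mem_ball_zero_iff, norm_sliceEmb]

open Metric Set Filter Topology

/-! ### Restriction of slice regular functions to slices. -/

theorem IsSliceRegularOn.fderiv_apply {f : ℍ → ℍ} {r : ℝ}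
    (hf : IsSliceRegularOn f (ball 0 r)) {I : ℍ} (hI : I ∈ imagUnits) {q : ℍ}
    (hq : q ∈ ball 0 r) (hqI : q ∈ slicePlane I) : fderiv ℝ f q I = I * fderiv ℝ f q 1 := by
  have hd := hf.1.differentiableAt (isOpen_ball.mem_nhds hq)
  have h := hf.2 I hI q ⟨hq, hqI⟩
  rw [hd.lineDeriv_eq_fderiv, hd.lineDeriv_eq_fderiv, smul_eq_zero] at h
  have h2 := congrArg (fun p => I * p) (h.resolve_left (by norm_num))
  simp only [mul_add, ← mul_assoc, mul_self_of_mem_imagUnits hI, mul_zero, neg_mul, one_mul] at h2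
  rw [add_neg_eq_zero] at h2
  exact h2.symm

/-- By the slice Cauchy–Riemann equation, the two halves of the non-real formula agree. -/
theorem IsSliceRegularOn.sliceDeriv_eq_fderiv {f : ℍ → ℍ} {r : ℝ}
    (hf : IsSliceRegularOn f (ball 0 r)) {q : ℍ} (hq : q ∈ ball 0 r) :
    sliceDeriv f q = fderiv ℝ f q 1 := by
  have hd := hf.1.differentiableAt (isOpen_ball.mem_nhds hq)
  have hI := imagUnit_mem_imagUnits q
  unfold sliceDeriv
  split_ifs with h
  · exact hd.lineDeriv_eq_fderiv
  · rw [hd.lineDeriv_eq_fderiv, hd.lineDeriv_eq_fderiv,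
      hf.fderiv_apply hI hq (mem_slicePlane_imagUnit q), ← mul_assoc, mul_self_of_mem_imagUnits hI,
      neg_mul, one_mul, sub_neg_eq_add, ← two_smul ℝ, smul_smul]
    norm_num

/-- The restriction of `f` to the slice `ℂ_I`, read in the coordinate `x + i y`. -/
noncomputable def sliceRestrict (f : ℍ → ℍ) {I : ℍ} (hI : I ∈ imagUnits) (z : ℂ) : ℂ :=
  sliceProj I (f (sliceEmb hI z))

theorem IsIntrinsicOn.sliceEmb_sliceRestrict {f : ℍ → ℍ} {r : ℝ} (hf : IsIntrinsicOn f (ball 0 r))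
    {I : ℍ} (hI : I ∈ imagUnits) {z : ℂ} (hz : z ∈ ball (0 : ℂ) r) :
    sliceEmb hI (sliceRestrict f hI z) = f (sliceEmb hI z) := by
  obtain ⟨w, hw⟩ := (mem_slicePlane_iff hI).1 (hf.2 I hI
    ⟨(sliceEmb_mem_ball_iff hI).2 hz, (mem_slicePlane_iff hI).2 ⟨z, rfl⟩⟩)
  rw [sliceRestrict, ← hw, sliceProj_sliceEmb]

theorem IsSliceRegularOn.differentiableOn_sliceRestrict {f : ℍ → ℍ} {r : ℝ}
    (hf : IsSliceRegularOn f (ball 0 r)) {I : ℍ} (hI : I ∈ imagUnits) :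
    DifferentiableOn ℂ (sliceRestrict f hI) (ball 0 r) := by
  intro z hz
  refine DifferentiableAt.differentiableWithinAt ?_
  have hq := (sliceEmb_mem_ball_iff hI).2 hz
  have hd := (hf.1.differentiableAt (isOpen_ball.mem_nhds hq)).hasFDerivAt
  have hc : HasFDerivAt (sliceRestrict f hI)
      ((sliceProj I).comp ((fderiv ℝ f (sliceEmb hI z)).comp (sliceEmbL hI))) z :=
    (sliceProj I).hasFDerivAt.comp z
      (HasFDerivAt.comp (f := sliceEmbL hI) z hd (sliceEmbL hI).hasFDerivAt)
  rw [differentiableAt_complex_iff_differentiableAt_real]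
  refine ⟨hc.differentiableAt, ?_⟩
  rw [hc.fderiv]
  simp only [ContinuousLinearMap.comp_apply, sliceEmbL_apply, sliceEmb_I, map_one]
  rw [hf.fderiv_apply hI hq ((mem_slicePlane_iff hI).2 ⟨z, rfl⟩), sliceProj_mul hI, smul_eq_mul]

/-- Two expressions for the real derivative of `z ↦ f (sliceEmb hI z)` are compared on the vector
`1`. -/
theorem IsIntrinsicOn.sliceDeriv_sliceEmb {f : ℍ → ℍ} {r : ℝ} (hf : IsIntrinsicOn f (ball 0 r))
    {I : ℍ} (hI : I ∈ imagUnits) {z : ℂ} (hz : z ∈ ball (0 : ℂ) r) :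
    sliceDeriv f (sliceEmb hI z) = sliceEmb hI (deriv (sliceRestrict f hI) z) := by
  have hq := (sliceEmb_mem_ball_iff hI).2 hz
  rw [hf.1.sliceDeriv_eq_fderiv hq]
  have hd := (hf.1.1.differentiableAt (isOpen_ball.mem_nhds hq)).hasFDerivAt
  have h1 : HasFDerivAt (fun z => f (sliceEmb hI z))
      ((fderiv ℝ f (sliceEmb hI z)).comp (sliceEmbL hI)) z :=
    HasFDerivAt.comp (f := sliceEmbL hI) z hd (sliceEmbL hI).hasFDerivAt
  have h2 : HasFDerivAt (fun z => sliceEmb hI (sliceRestrict f hI z))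
      ((sliceEmbL hI).comp (deriv (sliceRestrict f hI) z • (1 : ℂ →L[ℝ] ℂ))) z :=
    (sliceEmbL hI).hasFDerivAt.comp z ((hf.1.differentiableOn_sliceRestrict hI).differentiableAt
      (isOpen_ball.mem_nhds hz)).hasDerivAt.complexToReal_fderiv
  have h3 : (fun z => f (sliceEmb hI z)) =ᶠ[𝓝 z] fun z => sliceEmb hI (sliceRestrict f hI z) := by
    filter_upwards [isOpen_ball.mem_nhds hz] with w hw using (hf.sliceEmb_sliceRestrict hI hw).symm
  have h4 := congrArg (fun L => L (1 : ℂ)) (h1.unique (h2.congr_of_eventuallyEq h3))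
  simpa [sliceEmbL_apply] using h4

/-- The slices of `i` and `j` already meet only in `ℝ`. -/
theorem im_eq_zero_of_mem_slicePlane {q : ℍ} (h : ∀ I ∈ imagUnits, q ∈ slicePlane I) :
    q.im = 0 := by
  have hnorm : ∀ p : ℍ, Quaternion.normSq p = 1 → ‖p‖ = 1 := by
    intro p hp
    rw [Quaternion.normSq_eq_norm_mul_self] at hp
    nlinarith [norm_nonneg p]
  obtain ⟨u, u0, u1, u2, u3⟩ : ∃ u : ℍ, u.re = 0 ∧ u.imI = 1 ∧ u.imJ = 0 ∧ u.imK = 0 :=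
    ⟨⟨0, 1, 0, 0⟩, rfl, rfl, rfl, rfl⟩
  obtain ⟨v, v0, v1, v2, v3⟩ : ∃ v : ℍ, v.re = 0 ∧ v.imI = 0 ∧ v.imJ = 1 ∧ v.imK = 0 :=
    ⟨⟨0, 0, 1, 0⟩, rfl, rfl, rfl, rfl⟩
  obtain ⟨x, y, h1⟩ := h u ⟨u0, hnorm u (by simp [Quaternion.normSq_def', u0, u1, u2, u3])⟩
  obtain ⟨x', y', h2⟩ := h v ⟨v0, hnorm v (by simp [Quaternion.normSq_def', v0, v1, v2, v3])⟩
  have e2 : q.imI = 0 := by rw [h2]; simp [v1]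
  have e3 : q.imJ = 0 := by rw [h1]; simp [u2]
  have e4 : q.imK = 0 := by rw [h1]; simp [u3]
  ext <;> simp [e2, e3, e4]

/-- Schwarz reflection: at a real point the value of `f` lies in every slice, so it is real. The
restriction and its reflection agree on the real axis, and the identity theorem extends this to the
disk. -/
theorem IsIntrinsicOn.sliceRestrict_conj {f : ℍ → ℍ} {r : ℝ} (hf : IsIntrinsicOn f (ball 0 r))
    {I : ℍ} (hI : I ∈ imagUnits) {z : ℂ} (hz : z ∈ ball (0 : ℂ) r) :
    sliceRestrict f hI ((starRingEnd ℂ) z) = (starRingEnd ℂ) (sliceRestrict f hI z) := by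
  set φ := sliceRestrict f hI with hφ
  have hr : 0 < r := pos_of_mem_ball hz
  have hd : DifferentiableOn ℂ φ (ball 0 r) := hf.1.differentiableOn_sliceRestrict hI
  have hball : ∀ w ∈ ball (0 : ℂ) r, (starRingEnd ℂ) w ∈ ball (0 : ℂ) r := by
    intro w hw
    rw [mem_ball_zero_iff] at *
    rwa [RCLike.norm_conj]
  have hd2 : DifferentiableOn ℂ (fun w => (starRingEnd ℂ) (φ ((starRingEnd ℂ) w))) (ball 0 r) := by
    intro w hw
    have h1 := (hd.differentiableAt (isOpen_ball.mem_nhds (hball w hw))).conj_conj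
    rw [Complex.conj_conj] at h1
    exact h1.differentiableWithinAt
  have hreal : ∀ x : ℝ, (x : ℂ) ∈ ball (0 : ℂ) r → (starRingEnd ℂ) (φ x) = φ x := by
    intro x hx
    have hx0 : (f (x : ℍ)).im = 0 := by
      refine im_eq_zero_of_mem_slicePlane fun J hJ => ?_
      have h1 := hf.sliceEmb_sliceRestrict hJ hx
      rw [sliceEmb_ofReal] at h1
      exact (mem_slicePlane_iff hJ).2 ⟨_, h1⟩
    have h2 : f (x : ℍ) = ((f (x : ℍ)).re : ℍ) := by
      conv_lhs => rw [← Quaternion.re_add_im (f (x : ℍ)), hx0, add_zero]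
    rw [hφ, sliceRestrict, sliceEmb_ofReal, h2, ← sliceEmb_ofReal hI, sliceProj_sliceEmb,
      Complex.conj_ofReal]
  have hfreq : ∃ᶠ w in 𝓝[≠] (0 : ℂ), φ w = (starRingEnd ℂ) (φ ((starRingEnd ℂ) w)) := by
    have ht : Tendsto (fun x : ℝ => (x : ℂ)) (𝓝[>] 0) (𝓝[≠] 0) := by
      refine tendsto_nhdsWithin_of_tendsto_nhds_of_eventually_within _ ?_ ?_
      · exact (Complex.continuous_ofReal.tendsto' 0 0 Complex.ofReal_zero).mono_left
          nhdsWithin_le_nhds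
      · filter_upwards [self_mem_nhdsWithin] with x hx
        simpa using (ne_of_gt hx)
    refine ht.frequently (Eventually.frequently ?_)
    filter_upwards [Ioo_mem_nhdsGT hr] with x hx
    rw [Complex.conj_ofReal, hreal x]
    rw [mem_ball_zero_iff, Complex.norm_real, Real.norm_of_nonneg hx.1.le]
    exact hx.2
  have heq := (hd.analyticOnNhd isOpen_ball).eqOn_of_preconnected_of_frequently_eq
    (hd2.analyticOnNhd isOpen_ball) (convex_ball (0 : ℂ) r).isPreconnected (mem_ball_self hr) hfreq
  have := heq (hball z hz)
  simpa using this

theorem IsIntrinsicOn.deriv_sliceRestrict_conj {f : ℍ → ℍ} {r : ℝ}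
    (hf : IsIntrinsicOn f (ball 0 r)) {I : ℍ} (hI : I ∈ imagUnits) {z : ℂ}
    (hz : z ∈ ball (0 : ℂ) r) :
    deriv (sliceRestrict f hI) ((starRingEnd ℂ) z) =
      (starRingEnd ℂ) (deriv (sliceRestrict f hI) z) := by
  have hd := ((hf.1.differentiableOn_sliceRestrict hI).differentiableAt
    (isOpen_ball.mem_nhds hz)).hasDerivAt
  have hz' : (starRingEnd ℂ) z ∈ ball (0 : ℂ) r := by
    rw [mem_ball_zero_iff] at *
    rwa [RCLike.norm_conj]
  have h1 := hd.conj_conj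
  refine (h1.congr_of_eventuallyEq ?_).deriv
  filter_upwards [isOpen_ball.mem_nhds hz'] with w hw
  have := hf.sliceRestrict_conj hI hw
  rw [Function.comp, Function.comp, this, Complex.conj_conj]

/-! ### Star operations on intrinsic functions. -/

section StarMul

variable {F G : ℍ → ℍ} {q : ℍ} {w v : ℂ}

theorem stemRe_eq {I : ℍ} (hI : I ∈ imagUnits) (h1 : F q = sliceEmb hI w)
    (h2 : F (star q) = sliceEmb hI ((starRingEnd ℂ) w)) : stemRe F q = sliceEmb hI (w.re : ℂ) := by
  rw [stemRe, h1, h2, ← map_add, ← map_smul]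
  congr 1
  apply Complex.ext <;> simp
  ring

theorem stemIm_eq (h1 : F q = sliceEmb (imagUnit_mem_imagUnits q) w)
    (h2 : F (star q) = sliceEmb (imagUnit_mem_imagUnits q) ((starRingEnd ℂ) w)) :
    stemIm F q = sliceEmb (imagUnit_mem_imagUnits q) (w.im : ℂ) := by
  have h3 := sliceEmb_I (imagUnit_mem_imagUnits q)
  rw [stemIm, h1, h2]
  conv_lhs =>
    enter [1, 2, 1]
    rw [← h3]
  rw [← map_sub, ← map_mul, ← map_smul, ← map_neg]
  congr 1
  apply Complex.ext <;> simp
  ring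

theorem regConj_eq (h1 : F q = sliceEmb (imagUnit_mem_imagUnits q) w)
    (h2 : F (star q) = sliceEmb (imagUnit_mem_imagUnits q) ((starRingEnd ℂ) w)) :
    regConj F q = F q := by
  rw [regConj, stemRe_eq _ h1 h2, stemIm_eq h1 h2, ← sliceEmb_conj, ← sliceEmb_conj,
    Complex.conj_ofReal, Complex.conj_ofReal, sliceEmb_ofReal, sliceEmb_ofReal, h1, sliceEmb_apply]

/-- Conjugate values at conjugate points make the stem components the real numbers `Re` and `Im`, so
the defining formula is complex multiplication inside one slice. -/
theorem starMul_eq (h1 : F q = sliceEmb (imagUnit_mem_imagUnits q) w)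
    (h2 : F (star q) = sliceEmb (imagUnit_mem_imagUnits q) ((starRingEnd ℂ) w))
    (h3 : G q = sliceEmb (imagUnit_mem_imagUnits q) v)
    (h4 : G (star q) = sliceEmb (imagUnit_mem_imagUnits q) ((starRingEnd ℂ) v)) :
    starMul F G q = F q * G q := by
  have h5 := sliceEmb_I (imagUnit_mem_imagUnits q)
  rw [starMul, stemRe_eq _ h1 h2, stemIm_eq h1 h2, stemRe_eq _ h3 h4, stemIm_eq h3 h4, h1, h3]
  conv_lhs =>
    enter [2, 1]
    rw [← h5]
  simp only [← map_mul, ← map_add, ← map_sub]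
  congr 1
  apply Complex.ext <;> simp

end StarMul

theorem star_mem_ball {r : ℝ} {q : ℍ} (hq : q ∈ ball (0 : ℍ) r) : star q ∈ ball (0 : ℍ) r := by
  rw [mem_ball_zero_iff] at *
  rwa [norm_star]

theorem IsIntrinsicOn.exists_sliceEmb {f : ℍ → ℍ} {r : ℝ} (hf : IsIntrinsicOn f (ball 0 r))
    {q : ℍ} (hq : q ∈ ball (0 : ℍ) r) {I : ℍ} (hI : I ∈ imagUnits) (hqI : q ∈ slicePlane I) :
    ∃ w, f q = sliceEmb hI w ∧ f (star q) = sliceEmb hI ((starRingEnd ℂ) w) := by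
  obtain ⟨z, rfl⟩ := (mem_slicePlane_iff hI).1 hqI
  have hz := (sliceEmb_mem_ball_iff hI).1 hq
  have hq' := star_mem_ball hq
  rw [← sliceEmb_conj] at hq' ⊢
  have hz' := (sliceEmb_mem_ball_iff hI).1 hq'
  exact ⟨sliceRestrict f hI z, (hf.sliceEmb_sliceRestrict hI hz).symm, by
    rw [← hf.sliceRestrict_conj hI hz, hf.sliceEmb_sliceRestrict hI hz']⟩

theorem IsIntrinsicOn.regConj_eq_self {f : ℍ → ℍ} {r : ℝ} (hf : IsIntrinsicOn f (ball 0 r))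
    {q : ℍ} (hq : q ∈ ball (0 : ℍ) r) : regConj f q = f q := by
  obtain ⟨w, h1, h2⟩ := hf.exists_sliceEmb hq (imagUnit_mem_imagUnits q) (mem_slicePlane_imagUnit q)
  exact regConj_eq h1 h2

theorem IsIntrinsicOn.starInv_eq_inv {f : ℍ → ℍ} {r : ℝ} (hf : IsIntrinsicOn f (ball 0 r))
    {q : ℍ} (hq : q ∈ ball (0 : ℍ) r) : starInv f q = (f q)⁻¹ := by
  obtain ⟨w, h1, h2⟩ := hf.exists_sliceEmb hq (imagUnit_mem_imagUnits q) (mem_slicePlane_imagUnit q)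
  have h3 := hf.regConj_eq_self hq
  have h4 := hf.regConj_eq_self (star_mem_ball hq)
  rw [starInv, symmetrization, starMul_eq h1 h2 (h3.trans h1) (h4.trans h2), h3, mul_inv_rev,
    mul_assoc]
  -- At a zero of `f` both sides are `0` by the convention `0⁻¹ = 0`.
  by_cases h0 : f q = 0
  · simp [h0]
  · rw [inv_mul_cancel₀ h0, mul_one]

end SliceRegular

/-! ### Transfer from slices to the quaternionic ball. -/

open SliceRegular Metric Set in
theorem SliceRegular.IsNormalizedUnivalent.deriv_sliceRestrict_zero {f : ℍ → ℍ}
    (hS : IsNormalizedUnivalent f) (hN : IsIntrinsicOn f (ball 0 1)) {I : ℍ} (hI : I ∈ imagUnits) :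
    deriv (sliceRestrict f hI) 0 = 1 := by
  have h := hN.sliceDeriv_sliceEmb hI (mem_ball_self one_pos)
  rw [map_zero, hS.2.2.2, ← map_one (sliceEmb hI)] at h
  exact (sliceEmb_injective hI h).symm

open SliceRegular Metric Set in
theorem SliceRegular.IsNormalizedUnivalent.sliceRestrict_zero {f : ℍ → ℍ}
    (hS : IsNormalizedUnivalent f) {I : ℍ} (hI : I ∈ imagUnits) : sliceRestrict f hI 0 = 0 := by
  rw [sliceRestrict, map_zero, hS.2.2.1, map_zero]

open SliceRegular Metric Set in
theorem SliceRegular.IsNormalizedUnivalent.injOn_sliceRestrict {f : ℍ → ℍ}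
    (hS : IsNormalizedUnivalent f) (hN : IsIntrinsicOn f (ball 0 1)) {I : ℍ} (hI : I ∈ imagUnits) :
    InjOn (sliceRestrict f hI) (ball 0 1) := by
  intro a ha b hb hab
  have h := congrArg (sliceEmb hI) hab
  rw [hN.sliceEmb_sliceRestrict hI ha, hN.sliceEmb_sliceRestrict hI hb] at h
  exact sliceEmb_injective hI (hS.2.1 ((sliceEmb_mem_ball_iff hI).2 ha)
    ((sliceEmb_mem_ball_iff hI).2 hb) h)

open SliceRegular Metric Set in
-- Both factors stay in the slice of `q` and take conjugate values at `q` and `star q`, so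
-- `starMul_eq` applies.
theorem SliceRegular.IsIntrinsicOn.starMul_mul_sliceDeriv_starInv {f : ℍ → ℍ} {r : ℝ}
    (hN : IsIntrinsicOn f (ball 0 r)) {q : ℍ} (hq : q ∈ ball (0 : ℍ) r) :
    starMul (fun p => p * sliceDeriv f p) (starInv f) q = q * sliceDeriv f q * (f q)⁻¹ := by
  have hI := imagUnit_mem_imagUnits q
  obtain ⟨z, hz⟩ := exists_sliceEmb_eq q
  have hzb : z ∈ ball (0 : ℂ) r := (sliceEmb_mem_ball_iff hI).1 (by rwa [hz])
  have hq' := star_mem_ball hq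
  have hz' : sliceEmb hI ((starRingEnd ℂ) z) = star q := by rw [sliceEmb_conj, hz]
  have hzb' : (starRingEnd ℂ) z ∈ ball (0 : ℂ) r := (sliceEmb_mem_ball_iff hI).1 (by rwa [hz'])
  obtain ⟨w, h1, h2⟩ := hN.exists_sliceEmb hq hI (mem_slicePlane_imagUnit q)
  have h3 : sliceDeriv f q = _ := hz ▸ hN.sliceDeriv_sliceEmb hI hzb
  have h4 : sliceDeriv f (star q) = _ := hz' ▸ hN.sliceDeriv_sliceEmb hI hzb'
  rw [starMul_eq (w := z * deriv (sliceRestrict f hI) z) (v := w⁻¹) _ _ _ _, hN.starInv_eq_inv hq]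
  · rw [map_mul, hz, h3]
  · rw [h4, hN.deriv_sliceRestrict_conj hI hzb, ← hz', ← map_mul, map_mul (starRingEnd ℂ)]
  · rw [hN.starInv_eq_inv hq, h1, map_inv₀]
  · rw [hN.starInv_eq_inv hq', h2, map_inv₀ (starRingEnd ℂ), map_inv₀]

theorem mainTheorem4 (f : ℍ → ℍ)
    (hS : SliceRegular.IsNormalizedUnivalent f)
    (hN : SliceRegular.IsIntrinsicOn f (Metric.ball 0 1)) :
    Metric.ball (0 : ℍ) (1 / 4) ⊆ f '' Metric.ball 0 1 ∧
    (∀ (q : ℍ) (r : ℝ), ‖q‖ = r → 0 < r → r < 1 →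
      (1 - r) / (1 + r) ^ 3 ≤ ‖SliceRegular.sliceDeriv f q‖ ∧
        ‖SliceRegular.sliceDeriv f q‖ ≤ (1 + r) / (1 - r) ^ 3) ∧
    (∀ (q : ℍ) (r : ℝ), ‖q‖ = r → 0 < r → r < 1 →
      r / (1 + r) ^ 2 ≤ ‖f q‖ ∧ ‖f q‖ ≤ r / (1 - r) ^ 2) ∧
    (∀ (q : ℍ) (r : ℝ), ‖q‖ = r → 0 < r → r < 1 →
      (1 - r) / (1 + r) ≤
          ‖SliceRegular.starMul (fun p => p * SliceRegular.sliceDeriv f p)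
            (SliceRegular.starInv f) q‖ ∧
        ‖SliceRegular.starMul (fun p => p * SliceRegular.sliceDeriv f p)
            (SliceRegular.starInv f) q‖ ≤ (1 + r) / (1 - r)) ∧
    (∀ I ∈ SliceRegular.imagUnits, ∀ r : ℝ, 0 < r → r < 1 →
      IntervalIntegrable
        (fun θ : ℝ => ‖SliceRegular.sliceDeriv f
          ((r : ℍ) * ((Real.cos θ : ℍ) + I * (Real.sin θ : ℍ)))‖)
        MeasureTheory.volume 0 (2 * Real.pi) ∧
      r * ∫ θ in (0 : ℝ)..(2 * Real.pi), ‖SliceRegular.sliceDeriv f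
          ((r : ℍ) * ((Real.cos θ : ℍ) + I * (Real.sin θ : ℍ)))‖ ≤
        2 * Real.pi * r * (1 + r) / (1 - r) ^ 2) := by
  have hφd : ∀ {I : ℍ} (hI : I ∈ SliceRegular.imagUnits),
      DifferentiableOn ℂ (SliceRegular.sliceRestrict f hI) (Metric.ball 0 1) := fun hI =>
    hS.1.differentiableOn_sliceRestrict hI
  have hφi : ∀ {I : ℍ} (hI : I ∈ SliceRegular.imagUnits),
      Set.InjOn (SliceRegular.sliceRestrict f hI) (Metric.ball 0 1) := fun hI =>
    hS.injOn_sliceRestrict hN hI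
  have growth : ∀ (q : ℍ) (r : ℝ), ‖q‖ = r → 0 < r → r < 1 →
      r ≤ (1 + r) ^ 2 * ‖f q‖ ∧ (1 - r) ^ 2 * ‖f q‖ ≤ r ∧
      (1 - r) * (r * ‖SliceRegular.sliceDeriv f q‖) ≤ (1 + r) * ‖f q‖ ∧
      (1 - r) * ‖f q‖ ≤ (1 + r) * (r * ‖SliceRegular.sliceDeriv f q‖) := by
    intro q r hq hr0 hr1
    have hI := SliceRegular.imagUnit_mem_imagUnits q
    obtain ⟨z, hz⟩ := SliceRegular.exists_sliceEmb_eq q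
    have hzr : ‖z‖ = r := by rw [← hq, ← hz, SliceRegular.norm_sliceEmb]
    have hzb : z ∈ Metric.ball (0 : ℂ) 1 := by rwa [mem_ball_zero_iff, hzr]
    have e1 : ‖f q‖ = ‖SliceRegular.sliceRestrict f hI z‖ := by
      rw [← SliceRegular.norm_sliceEmb hI, hN.sliceEmb_sliceRestrict hI hzb, hz]
    have e2 : ‖SliceRegular.sliceDeriv f q‖ = ‖deriv (SliceRegular.sliceRestrict f hI) z‖ := by
      conv_lhs => rw [← hz]
      rw [hN.sliceDeriv_sliceEmb hI hzb, SliceRegular.norm_sliceEmb]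
    have h1 := norm_deriv_mul_le_norm_sub (hφd hI) (hφi hI) hzb
    have h2 := norm_sub_mul_le_norm_deriv (hφd hI) (hφi hI) hzb
    have h3 := norm_mul_norm_deriv_le (hφd hI) (hφi hI) hzb
    have h4 := mul_norm_sub_le_norm_mul_norm_deriv (hφd hI) (hφi hI) hzb
    rw [hS.sliceRestrict_zero hI, sub_zero, ← e1, hzr] at h1 h2 h3 h4
    rw [← e2] at h3 h4
    rw [hS.deriv_sliceRestrict_zero hN hI, norm_one, one_mul] at h1 h2
    exact ⟨h1, h2, h3, h4⟩
  refine ⟨?_, ?_, ?_, ?_, ?_⟩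
  · intro q hq
    have hI := SliceRegular.imagUnit_mem_imagUnits q
    obtain ⟨w, hw⟩ := SliceRegular.exists_sliceEmb_eq q
    have hwn : ‖w‖ < 1 / 4 := by
      rw [← SliceRegular.norm_sliceEmb hI, hw]
      simpa using hq
    by_contra hcon
    have := norm_deriv_le_four_mul_norm_sub_of_notMem (hφd hI) (hφi hI) (w := w) (by
      rintro ⟨z, hz, hzw⟩
      refine hcon ⟨SliceRegular.sliceEmb hI z, (SliceRegular.sliceEmb_mem_ball_iff hI).2 hz, ?_⟩
      rw [← hN.sliceEmb_sliceRestrict hI hz, hzw, hw])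
    rw [hS.sliceRestrict_zero hI, hS.deriv_sliceRestrict_zero hN hI, sub_zero, norm_one] at this
    linarith
  · intro q r hq hr0 hr1
    obtain ⟨h1, h2, h3, h4⟩ := growth q r hq hr0 hr1
    have hr2 : 0 < 1 - r := sub_pos.2 hr1
    rw [div_le_iff₀ (by positivity), le_div_iff₀ (by positivity)]
    constructor
    · refine le_of_mul_le_mul_left ?_ hr0
      -- The distortion bounds multiply a growth bound by a bound on `r‖∂_s f‖ / ‖f‖`, with `‖f q‖`
      -- eliminated.
      have h5 := mul_le_mul_of_nonneg_left h4 (by positivity : 0 ≤ (1 + r) ^ 2)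
      have h6 := mul_le_mul_of_nonneg_left h1 hr2.le
      linarith
    · refine le_of_mul_le_mul_left ?_ hr0
      have h5 := mul_le_mul_of_nonneg_left h3 (by positivity : 0 ≤ (1 - r) ^ 2)
      have h6 := mul_le_mul_of_nonneg_left h2 (by positivity : 0 ≤ 1 + r)
      linarith
  · intro q r hq hr0 hr1
    obtain ⟨h1, h2, -, -⟩ := growth q r hq hr0 hr1
    have hr2 : 0 < 1 - r := sub_pos.2 hr1
    rw [div_le_iff₀ (by positivity), le_div_iff₀ (by positivity)]
    constructor <;> linarith
  · intro q r hq hr0 hr1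
    obtain ⟨h1, h2, h3, h4⟩ := growth q r hq hr0 hr1
    have hr2 : 0 < 1 - r := sub_pos.2 hr1
    have hf0 : 0 < ‖f q‖ := by
      refine pos_of_mul_pos_right (hr0.trans_le h1) (by positivity)
    rw [hN.starMul_mul_sliceDeriv_starInv (by rwa [mem_ball_zero_iff, hq]), norm_mul, norm_mul,
      norm_inv, hq, ← div_eq_mul_inv, div_le_div_iff₀ (by positivity) hf0,
      div_le_div_iff₀ hf0 hr2]
    constructor <;> linarith
  · intro I hI r hr0 hr1
    have hr2 : 0 < 1 - r := sub_pos.2 hr1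
    have hcirc : ∀ θ : ℝ, (r : ℍ) * ((Real.cos θ : ℍ) + I * (Real.sin θ : ℍ)) =
        SliceRegular.sliceEmb hI (circleMap 0 r θ) := by
      intro θ
      have : circleMap 0 r θ = (r : ℂ) * ⟨Real.cos θ, Real.sin θ⟩ := by
        rw [circleMap_zero, Complex.exp_mul_I]
        apply Complex.ext <;> simp [Complex.cos_ofReal_re, Complex.sin_ofReal_re]
      rw [this, map_mul, SliceRegular.sliceEmb_ofReal, SliceRegular.sliceEmb_apply]
    have hcb : ∀ θ : ℝ, circleMap 0 r θ ∈ Metric.ball (0 : ℂ) 1 := by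
      intro θ
      rwa [mem_ball_zero_iff, norm_circleMap_zero, abs_of_pos hr0]
    have heq : ∀ θ : ℝ, ‖SliceRegular.sliceDeriv f
        ((r : ℍ) * ((Real.cos θ : ℍ) + I * (Real.sin θ : ℍ)))‖ =
        ‖deriv (SliceRegular.sliceRestrict f hI) (circleMap 0 r θ)‖ := by
      intro θ
      rw [hcirc, hN.sliceDeriv_sliceEmb hI (hcb θ), SliceRegular.norm_sliceEmb]
    have hc1 : Continuous fun θ => ‖deriv (SliceRegular.sliceRestrict f hI) (circleMap 0 r θ)‖ :=
      (((hφd hI).deriv Metric.isOpen_ball).continuousOn.comp_continuous (continuous_circleMap 0 r)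
        hcb).norm
    have hc2 : Continuous fun θ => ‖SliceRegular.sliceRestrict f hI (circleMap 0 r θ)‖ :=
      ((hφd hI).continuousOn.comp_continuous (continuous_circleMap 0 r) hcb).norm
    simp only [heq]
    refine ⟨hc1.intervalIntegrable _ _, ?_⟩
    have hL := circleAverage_norm_le_of_injOn (hφd hI) (hφi hI) (hS.sliceRestrict_zero hI)
      (hS.deriv_sliceRestrict_zero hN hI) hr0 hr1
    rw [Real.circleAverage_def, smul_eq_mul, inv_mul_le_iff₀ Real.two_pi_pos] at hL
    -- Pointwise domination of the derivative by the function reduces the integral to Littlewood's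
    -- bound `hL`.
    have hpt : ∀ θ : ℝ, r * ‖deriv (SliceRegular.sliceRestrict f hI) (circleMap 0 r θ)‖ ≤
        (1 + r) / (1 - r) * ‖SliceRegular.sliceRestrict f hI (circleMap 0 r θ)‖ := by
      intro θ
      have := norm_mul_norm_deriv_le (hφd hI) (hφi hI) (hcb θ)
      rw [hS.sliceRestrict_zero hI, sub_zero, norm_circleMap_zero, abs_of_pos hr0] at this
      rw [div_mul_eq_mul_div, le_div_iff₀ hr2]
      linarith
    calc r * ∫ θ in (0 : ℝ)..(2 * Real.pi),
          ‖deriv (SliceRegular.sliceRestrict f hI) (circleMap 0 r θ)‖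
        = ∫ θ in (0 : ℝ)..(2 * Real.pi),
          r * ‖deriv (SliceRegular.sliceRestrict f hI) (circleMap 0 r θ)‖ := by
          rw [intervalIntegral.integral_const_mul]
      _ ≤ ∫ θ in (0 : ℝ)..(2 * Real.pi),
          (1 + r) / (1 - r) * ‖SliceRegular.sliceRestrict f hI (circleMap 0 r θ)‖ :=
          intervalIntegral.integral_mono Real.two_pi_pos.le
            ((hc1.const_mul r).intervalIntegrable _ _) ((hc2.const_mul _).intervalIntegrable _ _) hpt
      _ = (1 + r) / (1 - r) * ∫ θ in (0 : ℝ)..(2 * Real.pi),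
          ‖SliceRegular.sliceRestrict f hI (circleMap 0 r θ)‖ := by
          rw [intervalIntegral.integral_const_mul]
      _ ≤ (1 + r) / (1 - r) * (2 * Real.pi * (r / (1 - r))) :=
          mul_le_mul_of_nonneg_left hL (by positivity)
      _ = 2 * Real.pi * r * (1 + r) / (1 - r) ^ 2 := by
          field_simp
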